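/- Consider a semi-Markov decision process (SMDP) with finite nonempty state space $\mathcal S$ and action space $\mathcal A$ (all actions admissible at every state): taking action $a$ at state $s$ leads, after a random holding time $\tau\ge 0$, to a random state $S$ with a random reward $R$ received at the transition, where $(S,\tau,R)$ has law $\mathbb P_{sa}$ on $\mathcal S\times\mathbb R_+\times\mathbb R$. Assume (a) for some $\epsilon>0$, $\mathbb P_{sa}(\tau\le\epsilon)<1$ for all $(s,a)$, and $\mathbb E_{sa}[\tau^2]<\infty$, $\mathbb E_{sa}[R^2]<\infty$ for all $(s,a)$; (b) the SMDP is weakly communicating: there is a unique nonempty set of states (closed communicating class) such that from any state in it every state in it is reachable with positive probability under some policy, while no state outside it is ever visited under any policy; and the remaining states are transient under all policies (almost surely visited only finitely often). Policies are history-dependent and randomized. Put $r_{sa}=\mathbb E_{sa}[R]$, $t_{sa}=\mathbb E_{sa}[\tau]$, $p^a_{ss'}=\mathbb P_{sa}(S=s')$, $d=|\mathcal S\times\mathcal A|$. For a policy $\pi$ and initial state $s$ let $r(\pi,s)=\liminf_{t\to\infty}t^{-1}\,\mathbb E^\pi_s\big[\sum_{n=1}^{N_t}R_n\big]$, where $\tau_n$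 and $R_n$ are the holding time and the reward of the $n$th transition and $N_t=\max\{n:\tau_1+\dots+\tau_n\le t\}$, and let $r^*=\sup_\pi r(\pi,s)$ be the optimal reward rate, which does not depend on $s$. Let $f:\mathbb R^d\to\mathbb R$ be Lipschitz continuous and such that, for every $x\in\mathbb R^d$, $c\mapsto f(x+c\mathbf 1)$ is strictly increasing from $\mathbb R$ onto $\mathbb R$. Assume further that the pointwise limit $f_\infty(x)=\lim_{c\to\infty}f(cx)/c$ exists in $\mathbb R$ for all $x$, and that $c\mapsto f_\infty(c\mathbf 1)$ is strictly increasing from $\mathbb R$ onto $\mathbb R$. Let $\mathcal Q_f$ be the set of all $q\in\mathbb R^d$ with $f(q)=r^*$ that solve, for some $\bar r\in\mathbb R$, the average-reward optimality equation $$q(s,a)=r_{sa}-t_{sa}\,\bar r+\sum_{s'\in\mathcal S}p^a_{ss'}\max_{a'\in\mathcal A}q(s',a')\qquad\text{for all }(s,a).$$ Fix $\bar\alpha\in(0,\min_{s,a}t_{sa}]$ and define $$\mathcal T(q)(s,a)=\frac{\bar\alpha\,r_{sa}}{t_{sa}}+\frac{\bar\alpha}{t_{sa}}\sum_{s'\in\mathcal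 S}p^a_{ss'}\max_{a'\in\mathcal A}q(s',a')+\Big(1-\frac{\bar\alpha}{t_{sa}}\Big)q(s,a),\qquad h(q)=\mathcal T(q)-q-\bar\alpha f(q)\mathbf 1 .$$ Then $E_h:=\{q\in\mathbb R^d: h(q)=0\}$ equals $\mathcal Q_f$, and this set is globally asymptotically stable for the ODE $\dot x(t)=h(x(t))$, $t\ge 0$: it is nonempty and compact; for every $\epsilon>0$ there is $\delta>0$ such that each solution starting at distance less than $\delta$ from $\mathcal Q_f$ stays at distance less than $\epsilon$ from $\mathcal Q_f$ for all $t\ge0$; and the distance from $x(t)$ to $\mathcal Q_f$ tends to $0$ for every solution $x(\cdot)$. Moreover, every solution converges, as $t\to\infty$, to a point of $\mathcal Q_f$ (which may depend on the solution). -/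

import Mathlib

open MeasureTheory ProbabilityTheory Filter Topology
open scoped NNReal ENNReal

noncomputable section

/-- A semi-Markov decision process with state space `S` and action space `A`, all actions being
admissible at every state.  `law s a` is the joint law of (next state, holding time, reward) when
action `a` is taken at state `s`. -/
structure SMDP (S A : Type*) [MeasurableSpace S] where
  law : S → A → Measure (S × ℝ≥0 × ℝ)
  isProb : ∀ s a, IsProbabilityMeasure (law s a)

namespace SMDP

/-- The data of one transition: (action taken, next state, holding time, reward). -/
abbrev Step (S A : Type*) : Type _ := A × S × ℝ≥0 × ℝ

/-- Histories `(s₀, (a₀, s₁, τ₁, r₁), …, (aₙ₋₁, sₙ, τₙ, rₙ))` up to the `n`th transition. -/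
abbrev Hist (S A : Type*) (n : ℕ) : Type _ := S × (Fin n → Step S A)

/-- The current state `sₙ` of a history. -/
def Hist.last {S A : Type*} : {n : ℕ} → Hist S A n → S
  | 0, h => h.1
  | n + 1, h => (h.2 (Fin.last n)).2.1

lemma measurable_last {S A : Type*} [MeasurableSpace S] [MeasurableSpace A] (n : ℕ) :
    Measurable (Hist.last : Hist S A n → S) := by
  cases n with
  | zero => exact measurable_fst
  | succ n => unfold Hist.last; fun_prop

/-- The history formed by the initial state `s` and the transitions number `0, …, n`. -/
def toHist {S A : Type*} (s : S) (n : ℕ) (ω : (i : Finset.Iic n) → Step S A) : Hist S A (n + 1) :=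
  (s, fun i => ω ⟨i, Finset.mem_Iic.2 (Nat.lt_succ_iff.1 i.2)⟩)

lemma measurable_toHist {S A : Type*} [MeasurableSpace S] [MeasurableSpace A] (s : S)
    (n : ℕ) : Measurable (toHist (A := A) s n) := by
  unfold toHist; fun_prop

/-- A (history-dependent, randomized) policy: a stochastic kernel from histories to actions for
every transition moment. -/
structure Policy (S A : Type*) [MeasurableSpace S] [MeasurableSpace A] where
  rule : (n : ℕ) → Kernel (Hist S A n) A
  isMarkov : ∀ n, IsMarkovKernel (rule n)

/-- The state `Sₙ` on a path started at `s`. -/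
def stateAt {S A : Type*} (s : S) (ω : ℕ → Step S A) : ℕ → S
  | 0 => s
  | n + 1 => (ω n).2.1

/-- The time `tₙ = τ₁ + ⋯ + τₙ` of the `n`th transition. -/
def transTime {S A : Type*} (ω : ℕ → Step S A) (n : ℕ) : ℝ := ∑ i ∈ Finset.range n, ((ω i).2.2.1 : ℝ)

/-- The number `N_t = max {n | tₙ ≤ t}` of transitions by time `t`. -/
def numTrans {S A : Type*} (ω : ℕ → Step S A) (t : ℝ) : ℕ := sSup {n : ℕ | transTime ω n ≤ t}

/-- The total reward `R₁ + ⋯ + R_{N_t}` received by time `t`. -/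
def totalReward {S A : Type*} (ω : ℕ → Step S A) (t : ℝ) : ℝ :=
  ∑ i ∈ Finset.range (numTrans ω t), (ω i).2.2.2

section Model

variable {S A : Type*} [MeasurableSpace S] (M : SMDP S A)

/-- Expected reward `r_{sa}`. -/
def reward (s : S) (a : A) : ℝ := ∫ w, w.2.2 ∂(M.law s a)

/-- Expected holding time `t_{sa}`. -/
def holding (s : S) (a : A) : ℝ := ∫ w, (w.2.1 : ℝ) ∂(M.law s a)

/-- Transition probability `p_{ss'}^a`. -/
def prob (s : S) (a : A) (s' : S) : ℝ := (M.law s a).real {w | w.1 = s'}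

/-- The conditions on the model: (i) for some `ε > 0`, every holding time exceeds `ε` with positive
probability; (ii) holding times and rewards have finite second moments. -/
structure ModelConditions : Prop where
  holding_pos : ∃ ε : ℝ, 0 < ε ∧ ∀ s a, M.law s a {w | (w.2.1 : ℝ) ≤ ε} < 1
  holding_sq : ∀ s a, Integrable (fun w => (w.2.1 : ℝ) ^ 2) (M.law s a)
  reward_sq : ∀ s a, Integrable (fun w => w.2.2 ^ 2) (M.law s a)

end Model

section PathLaw

variable {S A : Type*} [Finite S] [Finite A] [MeasurableSpace S] [MeasurableSpace A]
  [MeasurableSingletonClass S] [MeasurableSingletonClass A] (M : SMDP S A)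

/-- The transition laws as a kernel. -/
def kernel : Kernel (S × A) (S × ℝ≥0 × ℝ) := Kernel.ofFunOfCountable fun x => M.law x.1 x.2

instance : IsMarkovKernel M.kernel := ⟨fun x => M.isProb x.1 x.2⟩

/-- The conditional law of the next transition given the history, when following `π`: the action is
drawn from `π`, then (next state, holding time, reward) from the model. -/
def stepKernel (π : Policy S A) (n : ℕ) : Kernel (Hist S A n) (Step S A) :=
  π.rule n ⊗ₖ M.kernel.comap (fun x : Hist S A n × A => (x.1.last, x.2))
    (((measurable_last n).comp measurable_fst).prodMk measurable_snd)

instance (π : Policy S A) (n : ℕ) : IsMarkovKernel (M.stepKernel π n) := by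
  have := π.isMarkov n
  unfold stepKernel
  infer_instance

/-- The law of the sequence of transitions induced by the policy `π` and the initial state `s`. -/
def pathLaw (π : Policy S A) (s : S) : Measure (ℕ → Step S A) :=
  Kernel.trajMeasure (X := fun _ => Step S A) (M.stepKernel π 0 (s, Fin.elim0))
    fun n => (M.stepKernel π (n + 1)).comap (toHist s n) (measurable_toHist s n)

/-- The average reward rate `r(π, s)`. -/
def avgReward (π : Policy S A) (s : S) : EReal :=
  liminf (fun t : ℝ => ((t⁻¹ * ∫ ω, totalReward ω t ∂(M.pathLaw π s) : ℝ) : EReal)) atTop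

/-- The optimal reward rate `r*(s)`, the supremum over all policies. -/
def optReward (s : S) : EReal := ⨆ π : Policy S A, M.avgReward π s

/-- A nonempty set of states such that, from any state in it, every state in it is reachable with
positive probability under some policy, and no state outside it is ever visited under any policy. -/
structure IsClosedCommClass (C : Set S) : Prop where
  nonempty : C.Nonempty
  reachable : ∀ s ∈ C, ∀ s' ∈ C, ∃ π : Policy S A, 0 < M.pathLaw π s {ω | ∃ n, stateAt s ω n = s'}
  closed : ∀ s ∈ C, ∀ π : Policy S A, M.pathLaw π s {ω | ∃ n, stateAt s ω n ∉ C} = 0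

/-- The state `s` is transient under all policies: under every policy and from every initial state,
it is almost surely visited only finitely many times. -/
def IsTransientState (s : S) : Prop :=
  ∀ (π : Policy S A) (s₀ : S), M.pathLaw π s₀ {ω | ∃ᶠ n in atTop, stateAt s₀ ω n = s} = 0

/-- Weakly communicating: there is a unique closed communicating class, and the remaining states are
transient under all policies. -/
def WeaklyCommunicating : Prop :=
  ∃ C : Set S, M.IsClosedCommClass C ∧ (∀ C' : Set S, M.IsClosedCommClass C' → C' = C) ∧
    ∀ s ∉ C, M.IsTransientState s

end PathLaw

section Equations

variable {S A : Type*} [Fintype S] [Fintype A] [Nonempty A] [MeasurableSpace S] (M : SMDP S A)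

/-- `max_{a} q(s, a)`. -/
def maxQ (q : S × A → ℝ) (s : S) : ℝ :=
  Finset.univ.sup' Finset.univ_nonempty fun a : A => q (s, a)

/-- The average-reward optimality equation for the pair `(r, q)`. -/
def SolvesAOE (r : ℝ) (q : S × A → ℝ) : Prop :=
  ∀ s a, q (s, a) = M.reward s a - M.holding s a * r + ∑ s', M.prob s a s' * maxQ q s'

/-- The set `Q` of solutions `q` of the average-reward optimality equation. -/
def aoeSolutions : Set (S × A → ℝ) := {q | ∃ r : ℝ, M.SolvesAOE r q}

/-- The set `Q_f` of those solutions with `f(q) = r*`, where `r*` is the (constant) optimal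
reward rate. -/
def aoeSolutionsAt [MeasurableSpace A] [MeasurableSingletonClass S] [MeasurableSingletonClass A]
    (f : (S × A → ℝ) → ℝ) : Set (S × A → ℝ) :=
  {q | q ∈ M.aoeSolutions ∧ ∀ s, M.optReward s = (f q : EReal)}

/-- The dynamic programming operator of the equivalent MDP, with parameter `α`. -/
def dpOperator (α : ℝ) (q : S × A → ℝ) : S × A → ℝ := fun x =>
  α * M.reward x.1 x.2 / M.holding x.1 x.2
    + α / M.holding x.1 x.2 * ∑ s', M.prob x.1 x.2 s' * maxQ q s'
    + (1 - α / M.holding x.1 x.2) * q x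

/-- The vector field `h(q) = T(q) - q - α f(q)`. -/
def rviField (α : ℝ) (f : (S × A → ℝ) → ℝ) (q : S × A → ℝ) : S × A → ℝ := fun x =>
  M.dpOperator α q x - q x - α * f q

end Equations

end SMDP

/-- `g` is strictly increasing under scalar translation at `x`: `c ↦ g (x + c)` is strictly
increasing and maps `ℝ` onto `ℝ`. -/
def SISTrAt {ι : Type*} (g : (ι → ℝ) → ℝ) (x : ι → ℝ) : Prop :=
  StrictMono (fun c : ℝ => g fun i => x i + c) ∧
    Function.Surjective (fun c : ℝ => g fun i => x i + c)

/-- The conditions on `f`: (i) it is Lipschitz and strictly increasing under scalar translation;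
(ii) the scaling limit `f_∞` exists pointwise and is strictly increasing under scalar translation at
the origin. -/
structure RateFunctionConditions {ι : Type*} [Fintype ι] (f : (ι → ℝ) → ℝ) : Prop where
  lipschitz : ∃ L : ℝ≥0, LipschitzWith L f
  sistr : ∀ x, SISTrAt f x
  scaling : ∃ fInf : (ι → ℝ) → ℝ,
    (∀ x, Tendsto (fun c : ℝ => f (c • x) / c) atTop (𝓝 (fInf x))) ∧ SISTrAt fInf 0

/-- `x` solves the autonomous equation `x' = h(x)` on `[0, ∞)`. -/
def IsForwardSolution {E : Type*} [NormedAddCommGroup E] [NormedSpace ℝ E] (h : E → E)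
    (x : ℝ → E) : Prop :=
  IsIntegralCurveOn x (fun _ => h) (Set.Ici 0)

/-- The nonempty compact set `K` is globally asymptotically stable for `x' = h(x)`: it is Lyapunov
stable, and every solution converges to it. -/
structure IsGloballyAsympStable {E : Type*} [NormedAddCommGroup E] [NormedSpace ℝ E] (h : E → E)
    (K : Set E) : Prop where
  nonempty : K.Nonempty
  isCompact : IsCompact K
  stable : ∀ ε > 0, ∃ δ > 0, ∀ x : ℝ → E, IsForwardSolution h x →
    Metric.infDist (x 0) K < δ → ∀ t ≥ 0, Metric.infDist (x t) K < ε
  attractive : ∀ x : ℝ → E, IsForwardSolution h x →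
    Tendsto (fun t => Metric.infDist (x t) K) atTop (𝓝 0)

end

/-! Let (r, q) solve the optimality equation and let v(s) = max_a q(s,a). Under any policy the
increment R - rτ + v(S') - v(S) has conditional mean q(s,a) - v(s) ≤ 0, with equality for a greedy
rule. Summing over the transitions begun by time t bounds the expected reward by rt + O(√t), and the
greedy policy attains rt - O(√t): the expected number of such transitions is O(t), and the single
transition straddling t costs O(√t) by the second moments. Hence r is the optimal rate
(`ModelConditions.optReward_eq`). Since h(q) = 0 says that q solves the equation with constant f(q),
zeros of h and points of Q_f coincide.

Weak communication leaves only constants as solutions of the zero-reward equation. By homogeneity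
and compactness, a bound on T(q) - q then bounds q up to an additive constant
(`WeaklyCommunicating.exists_norm_sub_le`). This controls the fixed points of q ↦ T((1-ε)q) as ε → 0
and yields a solution (`WeaklyCommunicating.exists_solvesAOE`); together with f(q) = r* it also
makes Q_f compact.

For the ODE, T commutes with adding constants, so x = y + z·1 with y' = T(y) - αr* - y and z' = α(r*
- f(y + z)), z(0) = 0. As T is nonexpansive for the sup norm, so is the y-flow, and its speed never
increases. If the speed had a positive limit, a coordinate attaining it at a late time would have
travelled at nearly that speed over a long interval, against boundedness. So the speed tends to 0, y
accumulates at a fixed point, and it converges there because the distance to a fixed point never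
increases. Strict monotonicity of c ↦ f(x + c) then makes z converge, and its uniformity over the
compact Q_f gives Lyapunov stability. -/

noncomputable section

/-! ### Histories and one-step conditioning under the path law. -/

namespace SMDP

/-- The history formed by the initial state `s` and the first `n` transitions of a path. -/
def histOf {S A : Type*} (s : S) (n : ℕ) (ω : ℕ → Step S A) : Hist S A n := (s, fun i => ω i)

lemma last_histOf {S A : Type*} (s : S) (n : ℕ) (ω : ℕ → Step S A) :
    (histOf s n ω).last = stateAt s ω n := by
  cases n <;> simp [histOf, Hist.last, stateAt]

section Measurability

variable {S A : Type*} [MeasurableSpace S] [MeasurableSpace A]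

@[fun_prop]
lemma measurable_histOf (s : S) (n : ℕ) : Measurable (histOf (A := A) s n) := by
  unfold histOf; fun_prop

@[fun_prop]
lemma measurable_transTime (n : ℕ) :
    Measurable (fun ω : ℕ → Step S A => transTime ω n) := by
  unfold transTime; fun_prop

end Measurability

section PathLaw

variable {S A : Type*} [Finite S] [Finite A] [MeasurableSpace S] [MeasurableSpace A]
  [MeasurableSingletonClass S] [MeasurableSingletonClass A] (M : SMDP S A)

instance (π : Policy S A) (s : S) : IsProbabilityMeasure (M.pathLaw π s) := by
  unfold pathLaw; infer_instance

lemma pathLaw_map_eval_zero (π : Policy S A) (s : S) :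
    (M.pathLaw π s).map (fun ω => ω 0) = M.stepKernel π 0 (s, Fin.elim0) := by
  set μ₀ := M.stepKernel π 0 (s, Fin.elim0)
  have h1 : (M.pathLaw π s).map (Preorder.frestrictLe 0) =
      μ₀.map (MeasurableEquiv.piUnique (fun i : Finset.Iic 0 => Step S A)).symm := by
    unfold pathLaw Kernel.trajMeasure
    rw [Measure.map_comp _ _ (by fun_prop), Kernel.traj_map_frestrictLe, Kernel.partialTraj_self,
      Measure.id_comp]
  have h2 : (fun ω : ℕ → Step S A => ω 0) =
      (MeasurableEquiv.piUnique (fun i : Finset.Iic 0 => Step S A)) ∘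
        Preorder.frestrictLe (π := fun _ => Step S A) 0 := by
    ext ω : 1
    rfl
  rw [h2, ← Measure.map_map (by fun_prop) (by fun_prop), h1, Measure.map_map (by fun_prop)
    (by fun_prop), MeasurableEquiv.self_comp_symm, Measure.map_id]

/-- Given the history, the next transition is distributed according to the step kernel. -/
lemma map_histOf_step (π : Policy S A) (s : S) (n : ℕ) :
    (M.pathLaw π s).map (fun ω => (histOf s n ω, ω n)) =
      (M.pathLaw π s).map (histOf s n) ⊗ₘ M.stepKernel π n := by
  cases n with
  | zero =>
    have h0 : histOf (A := A) s 0 = fun _ => (s, Fin.elim0) := by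
      ext ω : 1
      simp only [histOf, Prod.mk.injEq, true_and]
      exact Subsingleton.elim _ _
    ext B hB
    rw [Measure.compProd_apply hB, h0, Measure.map_const, measure_univ, one_smul,
      lintegral_dirac' _ (Kernel.measurable_kernel_prodMk_left hB), ← pathLaw_map_eval_zero,
      Measure.map_apply (by fun_prop) hB,
      Measure.map_apply (by fun_prop) (measurable_prodMk_left hB)]
    rfl
  | succ n =>
    have hh : histOf (A := A) s (n + 1) =
        toHist s n ∘ Preorder.frestrictLe (π := fun _ => Step S A) n := rfl
    -- The trajectory measure conditions on the transitions 0, …, n only; pushing forward along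
    -- `toHist` restores the fixed initial state.
    have key := Kernel.map_frestrictLe_trajMeasure_compProd_eq_map_trajMeasure
      (X := fun _ => Step S A) (μ₀ := M.stepKernel π 0 (s, Fin.elim0))
      (κ := fun n => (M.stepKernel π (n + 1)).comap (toHist s n) (measurable_toHist s n)) (a := n)
    change (M.pathLaw π s).map (Preorder.frestrictLe n) ⊗ₘ _ = (M.pathLaw π s).map _ at key
    have hm := measurable_toHist (A := A) s n
    ext B hB
    rw [Measure.compProd_apply hB, hh, ← Measure.map_map hm (by fun_prop),
      lintegral_map (Kernel.measurable_kernel_prodMk_left hB) hm]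
    have hB' : MeasurableSet ((Prod.map (toHist s n) id : _ × Step S A → _ × Step S A) ⁻¹' B) :=
      (hm.prodMap measurable_id) hB
    have := congrArg (fun m => m ((Prod.map (toHist s n) id : _ × Step S A → _ × Step S A) ⁻¹' B))
      key
    beta_reduce at this
    rw [Measure.compProd_apply hB', Measure.map_apply (by fun_prop) hB'] at this
    rw [Measure.map_apply (by fun_prop) hB]
    exact this.symm

/-- The action is drawn from the policy given the history. -/
lemma map_histOf_action (π : Policy S A) (s : S) (n : ℕ) :
    (M.pathLaw π s).map (fun ω => (histOf s n ω, (ω n).1)) =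
      (M.pathLaw π s).map (histOf s n) ⊗ₘ π.rule n := by
  have := π.isMarkov n
  have h := M.map_histOf_step π s n
  unfold stepKernel at h
  have h1 := congrArg (Measure.map MeasurableEquiv.prodAssoc.symm) h
  rw [Measure.compProd_assoc, Measure.map_map (by fun_prop) (by fun_prop)] at h1
  have h3 := congrArg Measure.fst h1
  rw [Measure.fst_compProd, Measure.fst, Measure.map_map (by fun_prop) (by fun_prop)] at h3
  exact h3

/-- Given the history and the action, the transition is distributed according to the model. -/
lemma map_histOf_action_step (π : Policy S A) (s : S) (n : ℕ) :
    (M.pathLaw π s).map (fun ω => ((histOf s n ω, (ω n).1), (ω n).2)) =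
      (M.pathLaw π s).map (fun ω => (histOf s n ω, (ω n).1)) ⊗ₘ
        M.kernel.comap (fun x : Hist S A n × A => (x.1.last, x.2))
          (((measurable_last n).comp measurable_fst).prodMk measurable_snd) := by
  have := π.isMarkov n
  have h := M.map_histOf_step π s n
  unfold stepKernel at h
  have h1 := congrArg (Measure.map MeasurableEquiv.prodAssoc.symm) h
  rw [Measure.compProd_assoc, Measure.map_map (by fun_prop) (by fun_prop)] at h1
  rw [map_histOf_action, ← h1]
  rfl

/-- The integral of a function of the history, weighted by a function of the next transition, is
obtained by averaging the latter over the model. -/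
lemma integral_mul_step (π : Policy S A) (s : S) (n : ℕ) {φ : Hist S A n → ℝ} (hφ : Measurable φ)
    (hφ1 : ∀ h, |φ h| ≤ 1) {G : S → A → S × ℝ≥0 × ℝ → ℝ} (hGm : ∀ s a, Measurable (G s a))
    (hG : ∀ s a, Integrable (G s a) (M.law s a)) :
    Integrable (fun ω => φ (histOf s n ω) * G (stateAt s ω n) (ω n).1 (ω n).2) (M.pathLaw π s) ∧
    ∫ ω, φ (histOf s n ω) * G (stateAt s ω n) (ω n).1 (ω n).2 ∂(M.pathLaw π s) =
      ∫ ω, φ (histOf s n ω) * ∫ w, G (stateAt s ω n) (ω n).1 w ∂(M.law (stateAt s ω n) (ω n).1)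
        ∂(M.pathLaw π s) := by
  have hGm' : Measurable (fun x : (S × A) × (S × ℝ≥0 × ℝ) => G x.1.1 x.1.2 x.2) :=
    measurable_from_prod_countable_right fun x => hGm x.1 x.2
  set κ := M.kernel.comap (fun x : Hist S A n × A => (x.1.last, x.2))
          (((measurable_last n).comp measurable_fst).prodMk measurable_snd) with hκ
  have hκa : ∀ x, κ x = M.law x.1.last x.2 := fun x => rfl
  have hl := measurable_last (S := S) (A := A) n
  set H : (Hist S A n × A) × (S × ℝ≥0 × ℝ) → ℝ := fun x => φ x.1.1 * G x.1.1.last x.1.2 x.2 with hH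
  have hHm : Measurable H :=
    (hφ.comp (measurable_fst.comp measurable_fst)).mul
      (hGm'.comp (((hl.comp (measurable_fst.comp measurable_fst)).prodMk
        (measurable_snd.comp measurable_fst)).prodMk measurable_snd))
  set m := (M.pathLaw π s).map (fun ω => (histOf s n ω, (ω n).1)) with hm
  have hmp : IsProbabilityMeasure m := Measure.isProbabilityMeasure_map (by fun_prop)
  have hmap : (M.pathLaw π s).map (fun ω => ((histOf s n ω, (ω n).1), (ω n).2)) = m ⊗ₘ κ :=
    M.map_histOf_action_step π s n
  -- There are finitely many state-action pairs, so the first absolute moments have a common bound.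
  obtain ⟨c, hc⟩ : ∃ c, ∀ x : S × A, ∫ w, ‖G x.1 x.2 w‖ ∂(M.law x.1 x.2) ≤ c := by
    obtain ⟨c, hc⟩ := (Set.finite_range
      fun x : S × A => ∫ w, ‖G x.1 x.2 w‖ ∂(M.law x.1 x.2)).bddAbove
    exact ⟨c, fun x => hc ⟨x, rfl⟩⟩
  have hHint : Integrable H (m ⊗ₘ κ) := by
    rw [Measure.integrable_compProd_iff hHm.aestronglyMeasurable]
    refine ⟨ae_of_all _ fun x => ?_, ?_⟩
    · rw [hκa]
      exact (hG x.1.last x.2).const_mul (φ x.1)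
    · refine Integrable.of_bound (C := c) ?_ (ae_of_all _ fun x => ?_)
      · exact (hHm.norm.stronglyMeasurable.integral_kernel_prod_right' (κ := κ)).aestronglyMeasurable
      · rw [Real.norm_of_nonneg (integral_nonneg fun _ => norm_nonneg _)]
        simp only [hH, norm_mul, hκa]
        rw [integral_const_mul]
        have h1 := hc (x.1.last, x.2)
        have h2 : (0:ℝ) ≤ ∫ w, ‖G x.1.last x.2 w‖ ∂(M.law x.1.last x.2) :=
          integral_nonneg fun _ => norm_nonneg _
        calc _ ≤ 1 * _ := mul_le_mul_of_nonneg_right (hφ1 x.1) h2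
          _ ≤ c := by rw [one_mul]; exact h1
  have hHc : (fun ω : ℕ → Step S A => φ (histOf s n ω) * G (stateAt s ω n) (ω n).1 (ω n).2) =
      H ∘ (fun ω => ((histOf s n ω, (ω n).1), (ω n).2)) := by
    ext ω
    simp [hH, last_histOf]
  refine ⟨?_, ?_⟩
  · rw [hHc, ← integrable_map_measure (by rw [hmap]; exact hHint.1) (by fun_prop), hmap]
    exact hHint
  · have h1 : ∫ ω, H ((histOf s n ω, (ω n).1), (ω n).2) ∂(M.pathLaw π s) =
        ∫ y, H y ∂(m ⊗ₘ κ) := by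
      rw [← hmap, integral_map (by fun_prop) hHm.aestronglyMeasurable]
    rw [hHc]
    change ∫ ω, H ((histOf s n ω, (ω n).1), (ω n).2) ∂(M.pathLaw π s) = _
    rw [h1, Measure.integral_compProd hHint, hm, integral_map (by fun_prop)
      ((hHm.stronglyMeasurable.integral_kernel_prod_right' (κ := κ)).aestronglyMeasurable)]
    refine integral_congr_ae (ae_of_all _ fun ω => ?_)
    simp only [hH, hκa]
    rw [integral_const_mul, last_histOf]

/-- The stationary deterministic policy given by a decision rule. -/
def stationaryPolicy (σ : S → A) : Policy S A where
  rule n := Kernel.deterministic (fun h => σ h.last)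
    ((measurable_of_finite σ).comp (measurable_last n))
  isMarkov _ := inferInstance

lemma ae_action_stationaryPolicy (σ : S → A) (s : S) (n : ℕ) :
    ∀ᵐ ω ∂(M.pathLaw (stationaryPolicy σ) s), (ω n).1 = σ (stateAt s ω n) := by
  have hσ : Measurable fun x : Hist S A n × A => σ x.1.last :=
    (measurable_of_finite σ).comp ((measurable_last n).comp measurable_fst)
  have h : ∀ᵐ x ∂((M.pathLaw (stationaryPolicy σ) s).map (fun ω => (histOf s n ω, (ω n).1))),
      x.2 = σ x.1.last := by
    rw [map_histOf_action]
    have hms : MeasurableSet {x : Hist S A n × A | x.2 = σ x.1.last} :=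
      measurableSet_eq_fun measurable_snd hσ
    have := (stationaryPolicy (S := S) σ).isMarkov n
    refine Measure.ae_compProd_of_ae_ae hms (ae_of_all _ fun h => ?_)
    simp only [stationaryPolicy, Kernel.deterministic_apply]
    rw [ae_dirac_iff (Set.to_countable _).measurableSet]
  have h2 := ae_of_ae_map (by fun_prop) h
  filter_upwards [h2] with ω hω
  rwa [last_histOf] at hω

/-- If all transitions from a set of states lead into that set, the process never leaves it. -/
lemma ae_stateAt_mem (π : Policy S A) (D : Set S) {s : S} (hs : s ∈ D)
    (hstep : ∀ n, ∀ᵐ ω ∂(M.pathLaw π s), stateAt s ω n ∈ D →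
      ∀ s' ∉ D, M.prob (stateAt s ω n) (ω n).1 s' = 0) :
    ∀ᵐ ω ∂(M.pathLaw π s), ∀ n, stateAt s ω n ∈ D := by
  have := M.isProb
  rw [ae_all_iff]
  intro n
  induction n with
  | zero => exact ae_of_all _ fun _ => hs
  | succ n ih =>
    have hDm : MeasurableSet D := D.toFinite.measurableSet
    have hEm : MeasurableSet {w : S × ℝ≥0 × ℝ | w.1 ∉ D} := measurable_fst hDm.compl
    have hGm : ∀ (_ : S) (_ : A), Measurable
        ({w : S × ℝ≥0 × ℝ | w.1 ∉ D}.indicator (1 : S × ℝ≥0 × ℝ → ℝ)) := fun _ _ =>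
      measurable_one.indicator hEm
    -- The integral is the probability of being in D at step n and outside D at step n + 1;
    -- conditioning on the action shows that it vanishes.
    obtain ⟨hi, he⟩ := M.integral_mul_step π s n
      (φ := (Hist.last ⁻¹' D).indicator 1) (measurable_one.indicator (measurable_last n hDm))
      (fun h => by by_cases hh : h ∈ Hist.last ⁻¹' D <;> simp [hh])
      (G := fun _ _ => {w : S × ℝ≥0 × ℝ | w.1 ∉ D}.indicator 1) hGm
      (fun s a => (integrable_const 1).indicator hEm)
    have h0 : ∫ ω, (Hist.last ⁻¹' D).indicator (1 : Hist S A n → ℝ) (histOf s n ω) *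
        ∫ w, {w : S × ℝ≥0 × ℝ | w.1 ∉ D}.indicator (1 : S × ℝ≥0 × ℝ → ℝ) w
          ∂(M.law (stateAt s ω n) (ω n).1) ∂(M.pathLaw π s) = 0 := by
      refine integral_eq_zero_of_ae ?_
      filter_upwards [hstep n] with ω hω
      by_cases hd : stateAt s ω n ∈ D
      · have hz : (M.law (stateAt s ω n) (ω n).1).real {w : S × ℝ≥0 × ℝ | w.1 ∉ D} = 0 := by
          have hu : {w : S × ℝ≥0 × ℝ | w.1 ∉ D} = ⋃ s' ∈ Dᶜ, {w | w.1 = s'} := by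
            ext w; simp
          rw [measureReal_eq_zero_iff, hu, measure_biUnion_null_iff (Set.to_countable _)]
          intro s' hs'
          exact (measureReal_eq_zero_iff).1 (hω hd s' hs')
        rw [integral_indicator_one hEm, hz]
        simp
      · simp [last_histOf, hd]
    have hnn : 0 ≤ fun ω : ℕ → Step S A => (Hist.last ⁻¹' D).indicator (1 : Hist S A n → ℝ)
        (histOf s n ω) * {w : S × ℝ≥0 × ℝ | w.1 ∉ D}.indicator (1 : S × ℝ≥0 × ℝ → ℝ) (ω n).2 :=
      fun ω => mul_nonneg (Set.indicator_nonneg (fun _ _ => zero_le_one) _)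
        (Set.indicator_nonneg (fun _ _ => zero_le_one) _)
    filter_upwards [(integral_eq_zero_iff_of_nonneg hnn hi).1 (he.trans h0), ih] with ω hω hd
    by_contra hc
    simp only [stateAt] at hc
    simp [last_histOf, hd, hc] at hω

end PathLaw

/-! ### Pathwise estimates for the transitions around time t. -/

section Paths

variable {S A : Type*}

/-- The indicator that the transition number `n` starts by time `t`. -/
def alive (t : ℝ) (ω : ℕ → Step S A) (n : ℕ) : ℝ := if transTime ω n ≤ t then 1 else 0

lemma transTime_zero (ω : ℕ → Step S A) : transTime ω 0 = 0 := by simp [transTime]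

lemma transTime_succ (ω : ℕ → Step S A) (n : ℕ) :
    transTime ω (n + 1) = transTime ω n + ((ω n).2.2.1 : ℝ) := by
  simp [transTime, Finset.sum_range_succ]

lemma monotone_transTime (ω : ℕ → Step S A) : Monotone (transTime ω) :=
  monotone_nat_of_le_succ fun n => by
    rw [transTime_succ]; linarith [(ω n).2.2.1.coe_nonneg]

lemma alive_nonneg (t : ℝ) (ω : ℕ → Step S A) (n : ℕ) : 0 ≤ alive t ω n := by
  unfold alive; split_ifs <;> norm_num

lemma alive_le_one (t : ℝ) (ω : ℕ → Step S A) (n : ℕ) : alive t ω n ≤ 1 := by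
  unfold alive; split_ifs <;> norm_num

lemma alive_succ_le (t : ℝ) (ω : ℕ → Step S A) (n : ℕ) : alive t ω (n + 1) ≤ alive t ω n := by
  have := monotone_transTime ω (Nat.le_succ n)
  unfold alive
  split_ifs with h1 h2 <;> first | exact absurd (this.trans h1) h2 | norm_num

/-- Holding times begun by time t sum to at most t plus the overshoot of the last one, and
truncation at 1 caps that overshoot. The induction needs the sharper bound with `transTime ω N`,
which is in force until time t is passed. -/
lemma sum_alive_mul_min_le {t : ℝ} (ht : 0 ≤ t) (ω : ℕ → Step S A) (N : ℕ) :
    ∑ n ∈ Finset.range N, alive t ω n * min ((ω n).2.2.1 : ℝ) 1 ≤ t + 1 := by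
  suffices h : ∑ n ∈ Finset.range N, alive t ω n * min ((ω n).2.2.1 : ℝ) 1 ≤
      min (transTime ω N) (t + 1) from h.trans (min_le_right _ _)
  induction N with
  | zero => simp [transTime_zero]; linarith
  | succ N ih =>
    rw [Finset.sum_range_succ, transTime_succ]
    have h0 := (ω N).2.2.1.coe_nonneg
    have h1 := min_le_left ((ω N).2.2.1 : ℝ) 1
    have h2 := min_le_right ((ω N).2.2.1 : ℝ) 1
    rw [le_min_iff] at ih ⊢
    unfold alive at ih ⊢
    split_ifs with h
    · constructor <;> linarith [ih.1]
    · constructor <;> linarith [ih.1, ih.2]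

lemma sum_alive_succ_mul_le {t : ℝ} (ht : 0 ≤ t) (ω : ℕ → Step S A) (N : ℕ) :
    ∑ n ∈ Finset.range N, alive t ω (n + 1) * ((ω n).2.2.1 : ℝ) ≤ t := by
  suffices h : ∑ n ∈ Finset.range N, alive t ω (n + 1) * ((ω n).2.2.1 : ℝ) ≤
      min (transTime ω N) t from h.trans (min_le_right _ _)
  induction N with
  | zero => simp [transTime_zero, ht]
  | succ N ih =>
    rw [Finset.sum_range_succ]
    have h0 := (ω N).2.2.1.coe_nonneg
    have h1 := transTime_succ ω N
    rw [le_min_iff] at ih ⊢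
    unfold alive at ih ⊢
    split_ifs with h
    · constructor <;> linarith [ih.1]
    · constructor <;> linarith [ih.1, ih.2]

/-- Once time t has been passed, the transitions begun by t cover [0, t]. The factor `1 - alive t ω
N` voids the bound when N transitions do not yet get past t. -/
lemma le_sum_alive_mul {t : ℝ} (ht : 0 ≤ t) (ω : ℕ → Step S A) (N : ℕ) :
    t * (1 - alive t ω N) ≤ ∑ n ∈ Finset.range N, alive t ω n * ((ω n).2.2.1 : ℝ) := by
  have h : min (transTime ω N) t ≤
      ∑ n ∈ Finset.range N, alive t ω n * ((ω n).2.2.1 : ℝ) := by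
    induction N with
    | zero => simp [transTime_zero, ht]
    | succ N ih =>
      rw [Finset.sum_range_succ]
      have h0 := (ω N).2.2.1.coe_nonneg
      have h1 := transTime_succ ω N
      rw [min_le_iff] at ih ⊢
      by_cases h : transTime ω N ≤ t
      · simp only [alive, h, if_true] at ih ⊢
        left
        rcases ih with ih | ih <;> linarith
      · right
        simp only [alive, h, if_false] at ih ⊢
        rcases ih with ih | ih <;> linarith
  refine le_trans ?_ h
  rw [le_min_iff]
  unfold alive
  split_ifs with h
  · have := monotone_transTime ω (Nat.zero_le N)
    rw [transTime_zero] at this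
    constructor <;> linarith
  · constructor <;> linarith

lemma sum_alive_sub (t : ℝ) (ω : ℕ → Step S A) (N : ℕ) :
    ∑ n ∈ Finset.range N, (alive t ω n - alive t ω (n + 1)) ≤ 1 := by
  rw [Finset.sum_range_sub']
  linarith [alive_nonneg t ω N, alive_le_one t ω 0]

/-- Summation by parts: two boundary terms of size at most B remain, plus a sum with nonnegative
weights of total at most 1. -/
lemma abs_sum_alive_mul_sub_le (t : ℝ) (s : S) (ω : ℕ → Step S A) {v : S → ℝ} {B : ℝ}
    (hv : ∀ s, |v s| ≤ B) (N : ℕ) :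
    |∑ n ∈ Finset.range N, alive t ω n * (v (stateAt s ω (n + 1)) - v (stateAt s ω n))| ≤ 3 * B := by
  have hB : 0 ≤ B := (abs_nonneg _).trans (hv s)
  have h1 : ∑ n ∈ Finset.range N, alive t ω n * (v (stateAt s ω (n + 1)) - v (stateAt s ω n)) =
      (alive t ω N * v (stateAt s ω N) - alive t ω 0 * v (stateAt s ω 0)) +
      ∑ n ∈ Finset.range N, (alive t ω n - alive t ω (n + 1)) * v (stateAt s ω (n + 1)) := by
    rw [← Finset.sum_range_sub (fun n => alive t ω n * v (stateAt s ω n)), ← Finset.sum_add_distrib]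
    exact Finset.sum_congr rfl fun n _ => by ring
  have h2 : ∀ n, |alive t ω n * v (stateAt s ω n)| ≤ B := fun n => by
    rw [abs_mul, abs_of_nonneg (alive_nonneg t ω n)]
    exact (mul_le_mul (alive_le_one t ω n) (hv _) (abs_nonneg _) zero_le_one).trans (one_mul B).le
  have h3 : |∑ n ∈ Finset.range N, (alive t ω n - alive t ω (n + 1)) * v (stateAt s ω (n + 1))|
      ≤ B := by
    refine (Finset.abs_sum_le_sum_abs _ _).trans ?_
    calc _ ≤ ∑ n ∈ Finset.range N, (alive t ω n - alive t ω (n + 1)) * B := by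
          refine Finset.sum_le_sum fun n _ => ?_
          rw [abs_mul, abs_of_nonneg (sub_nonneg.2 (alive_succ_le t ω n))]
          exact mul_le_mul_of_nonneg_left (hv _) (sub_nonneg.2 (alive_succ_le t ω n))
      _ ≤ 1 * B := by
          rw [← Finset.sum_mul]
          exact mul_le_mul_of_nonneg_right (sum_alive_sub t ω N) hB
      _ = B := one_mul B
  rw [h1]
  calc _ ≤ |alive t ω N * v (stateAt s ω N)| + |alive t ω 0 * v (stateAt s ω 0)| + B :=
        (abs_add_le _ _).trans (add_le_add (abs_sub _ _) h3)
    _ ≤ 3 * B := by linarith [h2 N, h2 0]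

/-- Only one transition straddles time `t`, so its contribution is controlled by the squares. -/
lemma sum_alive_sub_mul_abs_le (t : ℝ) (ω : ℕ → Step S A) (x : ℕ → ℝ) {K : ℝ} (hK : 0 < K)
    (N : ℕ) :
    ∑ n ∈ Finset.range N, (alive t ω n - alive t ω (n + 1)) * |x n| ≤
      1 / (2 * K) * ∑ n ∈ Finset.range N, alive t ω n * x n ^ 2 + K / 2 := by
  have h : ∀ n, (alive t ω n - alive t ω (n + 1)) * |x n| ≤
      1 / (2 * K) * (alive t ω n * x n ^ 2) + K / 2 * (alive t ω n - alive t ω (n + 1)) := by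
    intro n
    -- AM-GM. The square may then be weighted by the larger `alive t ω n`, which, unlike `alive t ω
    -- (n + 1)`, depends only on the history before transition n.
    have h1 : |x n| ≤ 1 / (2 * K) * x n ^ 2 + K / 2 := by
      rw [← sq_abs (x n)]
      have : 1 / (2 * K) * |x n| ^ 2 + K / 2 - |x n| = 1 / (2 * K) * (|x n| - K) ^ 2 := by
        field_simp; ring
      have h2 : 0 ≤ 1 / (2 * K) * (|x n| - K) ^ 2 := by positivity
      linarith
    have h0 := sub_nonneg.2 (alive_succ_le t ω n)
    have h2 : 0 ≤ 1 / (2 * K) * x n ^ 2 := by positivity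
    calc _ ≤ (alive t ω n - alive t ω (n + 1)) * (1 / (2 * K) * x n ^ 2 + K / 2) :=
          mul_le_mul_of_nonneg_left h1 h0
      _ ≤ _ := by nlinarith [mul_nonneg (alive_nonneg t ω (n + 1)) h2]
  calc _ ≤ ∑ n ∈ Finset.range N, (1 / (2 * K) * (alive t ω n * x n ^ 2) +
        K / 2 * (alive t ω n - alive t ω (n + 1))) := Finset.sum_le_sum fun n _ => h n
    _ ≤ _ := by
      rw [Finset.sum_add_distrib, ← Finset.mul_sum, ← Finset.mul_sum]
      have := mul_le_mul_of_nonneg_left (sum_alive_sub t ω N) (by positivity : 0 ≤ K / 2)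
      linarith

lemma totalReward_eq_tsum {t : ℝ} (ht : 0 ≤ t) {ω : ℕ → Step S A}
    (h : ∀ᶠ n in atTop, ¬ transTime ω n ≤ t) :
    totalReward ω t = ∑' n, alive t ω (n + 1) * (ω n).2.2.2 := by
  obtain ⟨N, hN⟩ := eventually_atTop.1 h
  -- Boundedness matters: the supremum of an unbounded set of naturals is 0 by convention, and
  -- `numTrans` would lose its meaning.
  have hb : BddAbove {n : ℕ | transTime ω n ≤ t} :=
    ⟨N, fun n hn => by by_contra hc; exact hN n (not_le.1 hc).le hn⟩
  have hne : {n : ℕ | transTime ω n ≤ t}.Nonempty := ⟨0, by simp [transTime_zero, ht]⟩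
  have hiff : ∀ n, n ≤ numTrans ω t ↔ transTime ω n ≤ t := fun n =>
    ⟨fun hn => (monotone_transTime ω hn).trans (Nat.sSup_mem hne hb), fun hn => le_csSup hb hn⟩
  rw [tsum_eq_sum (s := Finset.range (numTrans ω t))]
  · refine Finset.sum_congr rfl fun n hn => ?_
    rw [Finset.mem_range] at hn
    simp [alive, (hiff (n + 1)).1 hn]
  · intro n hn
    rw [Finset.mem_range, ← Nat.succ_le_iff, hiff] at hn
    simp [alive, hn]

/-- Pathwise comparison of the rewards received by time `t` with the sum of the increments
`Rₙ - r τₙ + v(Sₙ₊₁) - v(Sₙ)` over the transitions that start by time `t`. -/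
lemma abs_sum_reward_sub_le {t : ℝ} (ht : 0 ≤ t) (s : S) (ω : ℕ → Step S A) {v : S → ℝ} {B : ℝ}
    (hv : ∀ s, |v s| ≤ B) (r : ℝ) {K : ℝ} (hK : 0 < K) (N : ℕ) :
    |∑ n ∈ Finset.range N, alive t ω (n + 1) * (ω n).2.2.2 - r * t -
      ∑ n ∈ Finset.range N, alive t ω n *
        ((ω n).2.2.2 - r * ((ω n).2.2.1 : ℝ) + v (stateAt s ω (n + 1)) - v (stateAt s ω n))| ≤
    |r| * t * alive t ω N +
      1 / (2 * K) * ∑ n ∈ Finset.range N, alive t ω n * (|r| * ((ω n).2.2.1 : ℝ) ^ 2 +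
        (ω n).2.2.2 ^ 2) + ((|r| + 1) * K / 2 + 3 * B) := by
  -- If time t has been passed, ρ is the overshoot beyond t. Otherwise it can be as low as -t, which
  -- produces the error term with `alive t ω N`.
  set ρ := ∑ n ∈ Finset.range N, alive t ω n * ((ω n).2.2.1 : ℝ) - t with hρ
  have hτ := sum_alive_sub_mul_abs_le t ω (fun n => ((ω n).2.2.1 : ℝ)) hK N
  have hR := sum_alive_sub_mul_abs_le t ω (fun n => (ω n).2.2.2) hK N
  have hv' := abs_sum_alive_mul_sub_le t s ω hv N
  have hρ1 : ρ ≤ ∑ n ∈ Finset.range N, (alive t ω n - alive t ω (n + 1)) *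
      |((ω n).2.2.1 : ℝ)| := by
    have := sum_alive_succ_mul_le ht ω N
    have h2 : ∑ n ∈ Finset.range N, (alive t ω n - alive t ω (n + 1)) * |((ω n).2.2.1 : ℝ)| =
      ∑ n ∈ Finset.range N, alive t ω n * ((ω n).2.2.1 : ℝ) -
      ∑ n ∈ Finset.range N, alive t ω (n + 1) * ((ω n).2.2.1 : ℝ) := by
      rw [← Finset.sum_sub_distrib]
      refine Finset.sum_congr rfl fun n _ => ?_
      rw [abs_of_nonneg (ω n).2.2.1.coe_nonneg]; ring
    rw [h2]; linarith
  have hρ2 := le_sum_alive_mul ht ω N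
  have hq : 0 ≤ ∑ n ∈ Finset.range N, alive t ω n * ((ω n).2.2.1 : ℝ) ^ 2 :=
    Finset.sum_nonneg fun n _ => mul_nonneg (alive_nonneg t ω n) (sq_nonneg _)
  have hal := alive_nonneg t ω N
  have hρa : |ρ| ≤ t * alive t ω N +
      (1 / (2 * K) * ∑ n ∈ Finset.range N, alive t ω n * ((ω n).2.2.1 : ℝ) ^ 2 + K / 2) := by
    have h1 : 0 ≤ 1 / (2 * K) * ∑ n ∈ Finset.range N, alive t ω n * ((ω n).2.2.1 : ℝ) ^ 2 := by
      positivity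
    rw [abs_le]
    constructor <;> nlinarith
  have hRa : |∑ n ∈ Finset.range N, (alive t ω n - alive t ω (n + 1)) * (ω n).2.2.2| ≤
      1 / (2 * K) * ∑ n ∈ Finset.range N, alive t ω n * (ω n).2.2.2 ^ 2 + K / 2 := by
    refine (Finset.abs_sum_le_sum_abs _ _).trans (le_trans (Finset.sum_le_sum fun n _ => ?_) hR)
    rw [abs_mul, abs_of_nonneg (sub_nonneg.2 (alive_succ_le t ω n))]
  have hid : ∑ n ∈ Finset.range N, alive t ω (n + 1) * (ω n).2.2.2 - r * t -
      ∑ n ∈ Finset.range N, alive t ω n *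
        ((ω n).2.2.2 - r * ((ω n).2.2.1 : ℝ) + v (stateAt s ω (n + 1)) - v (stateAt s ω n)) =
      r * ρ - ∑ n ∈ Finset.range N, alive t ω n *
        (v (stateAt s ω (n + 1)) - v (stateAt s ω n)) -
      ∑ n ∈ Finset.range N, (alive t ω n - alive t ω (n + 1)) * (ω n).2.2.2 := by
    rw [hρ, mul_sub, Finset.mul_sum]
    have : ∑ n ∈ Finset.range N, alive t ω (n + 1) * (ω n).2.2.2 -
      ∑ n ∈ Finset.range N, alive t ω n *
        ((ω n).2.2.2 - r * ((ω n).2.2.1 : ℝ) + v (stateAt s ω (n + 1)) - v (stateAt s ω n)) =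
      ∑ n ∈ Finset.range N, r * (alive t ω n * ((ω n).2.2.1 : ℝ)) -
      ∑ n ∈ Finset.range N, alive t ω n *
        (v (stateAt s ω (n + 1)) - v (stateAt s ω n)) -
      ∑ n ∈ Finset.range N, (alive t ω n - alive t ω (n + 1)) * (ω n).2.2.2 := by
      simp only [← Finset.sum_sub_distrib]
      exact Finset.sum_congr rfl fun n _ => by ring
    linarith
  rw [hid]
  have hsplit : ∑ n ∈ Finset.range N, alive t ω n * (|r| * ((ω n).2.2.1 : ℝ) ^ 2 +
        (ω n).2.2.2 ^ 2) = |r| * ∑ n ∈ Finset.range N, alive t ω n * ((ω n).2.2.1 : ℝ) ^ 2 +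
        ∑ n ∈ Finset.range N, alive t ω n * (ω n).2.2.2 ^ 2 := by
    rw [Finset.mul_sum, ← Finset.sum_add_distrib]
    exact Finset.sum_congr rfl fun n _ => by ring
  rw [hsplit]
  have hrρ : |r * ρ| ≤ |r| * (t * alive t ω N +
      (1 / (2 * K) * ∑ n ∈ Finset.range N, alive t ω n * ((ω n).2.2.1 : ℝ) ^ 2 + K / 2)) := by
    rw [abs_mul]; exact mul_le_mul_of_nonneg_left hρa (abs_nonneg _)
  refine (abs_sub _ _).trans ((add_le_add_left (abs_sub _ _) _).trans ?_)
  linarith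

end Paths

/-! ### Moments of a single transition. -/

section OneStep

variable {S A : Type*} [MeasurableSpace S] {M : SMDP S A}

lemma ModelConditions.integrable_holding (hM : M.ModelConditions) (s : S) (a : A) :
    Integrable (fun w : S × ℝ≥0 × ℝ => (w.2.1 : ℝ)) (M.law s a) := by
  have := M.isProb s a
  refine ((integrable_const (1 : ℝ)).add (hM.holding_sq s a)).mono' (by fun_prop)
    (ae_of_all _ fun w => ?_)
  simp only [Pi.add_apply, Real.norm_eq_abs]
  rw [abs_le]
  constructor <;> nlinarith [sq_nonneg ((w.2.1 : ℝ) - 1), sq_nonneg ((w.2.1 : ℝ) + 1)]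

lemma ModelConditions.integrable_reward (hM : M.ModelConditions) (s : S) (a : A) :
    Integrable (fun w : S × ℝ≥0 × ℝ => w.2.2) (M.law s a) := by
  have := M.isProb s a
  refine ((integrable_const (1 : ℝ)).add (hM.reward_sq s a)).mono' (by fun_prop)
    (ae_of_all _ fun w => ?_)
  simp only [Pi.add_apply, Real.norm_eq_abs]
  rw [abs_le]
  constructor <;> nlinarith [sq_nonneg (w.2.2 - 1), sq_nonneg (w.2.2 + 1)]

/-- A zero mean would force τ = 0 almost surely, against `holding_pos`; finiteness of the set of
pairs makes the bound uniform. Truncation preserves positivity and matches `sum_alive_mul_min_le`.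
-/
lemma ModelConditions.exists_truncated_holding_pos [Finite S] [Finite A]
    (hM : M.ModelConditions) :
    ∃ c : ℝ, 0 < c ∧ ∀ s a, c ≤ ∫ w, min (w.2.1 : ℝ) 1 ∂(M.law s a) := by
  have hpos : ∀ x : S × A, 0 < ∫ w, min (w.2.1 : ℝ) 1 ∂(M.law x.1 x.2) := by
    intro x
    have := M.isProb x.1 x.2
    have hnn : 0 ≤ fun w : S × ℝ≥0 × ℝ => min (w.2.1 : ℝ) 1 := fun w =>
      le_min w.2.1.coe_nonneg zero_le_one
    have hi : Integrable (fun w : S × ℝ≥0 × ℝ => min (w.2.1 : ℝ) 1) (M.law x.1 x.2) :=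
      (hM.integrable_holding x.1 x.2).inf (integrable_const 1)
    refine lt_of_le_of_ne (integral_nonneg hnn) fun h0 => ?_
    have hz := (integral_eq_zero_iff_of_nonneg hnn hi).1 h0.symm
    obtain ⟨ε, hε, hlt⟩ := hM.holding_pos
    refine (hlt x.1 x.2).ne ((mem_ae_iff_prob_eq_one ?_).1 ?_)
    · exact measurableSet_le (by fun_prop) measurable_const
    · filter_upwards [hz] with w hw
      simp only [Pi.zero_apply] at hw
      rcases min_choice (w.2.1 : ℝ) 1 with h | h
      · rw [h] at hw
        show (w.2.1 : ℝ) ≤ ε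
        rw [hw]; exact hε.le
      · rw [h] at hw; norm_num at hw
  rcases isEmpty_or_nonempty (S × A) with h | h
  · exact ⟨1, one_pos, fun s a => (h.false (s, a)).elim⟩
  · obtain ⟨x, hx⟩ := Finite.exists_min fun x : S × A => ∫ w, min (w.2.1 : ℝ) 1 ∂(M.law x.1 x.2)
    exact ⟨_, hpos x, fun s a => hx (s, a)⟩

end OneStep

section AliveMeasurable

variable {S A : Type*} [MeasurableSpace S] [MeasurableSpace A]

@[fun_prop]
lemma measurable_alive (t : ℝ) (n : ℕ) :
    Measurable (fun ω : ℕ → Step S A => alive t ω n) :=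
  Measurable.ite (measurableSet_le (measurable_transTime n) measurable_const) measurable_const
    measurable_const

/-- The indicator `alive` as a function of the history. -/
def histAlive {S A : Type*} (t : ℝ) {n : ℕ} (h : Hist S A n) : ℝ :=
  if ∑ i, ((h.2 i).2.2.1 : ℝ) ≤ t then 1 else 0

lemma histAlive_histOf {S A : Type*} (t : ℝ) (s : S) {n : ℕ} (ω : ℕ → Step S A) :
    histAlive t (histOf s n ω) = alive t ω n := by
  have h : transTime ω n = ∑ i : Fin n, (((histOf s n ω).2 i).2.2.1 : ℝ) :=
    Finset.sum_range _
  unfold alive histAlive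
  simp only [h]

lemma measurable_histAlive (t : ℝ) (n : ℕ) : Measurable (histAlive (S := S) (A := A) t (n := n)) :=
  Measurable.ite (measurableSet_le (by fun_prop) measurable_const) measurable_const measurable_const

end AliveMeasurable

/-! ### Expected number of transitions and expected reward by time t. -/

section Expectations

variable {S A : Type*} [Finite S] [Finite A] [MeasurableSpace S] [MeasurableSpace A]
  [MeasurableSingletonClass S] [MeasurableSingletonClass A] (M : SMDP S A)

lemma integral_alive_mul_step (π : Policy S A) (s : S) (t : ℝ) (n : ℕ)
    {G : S → A → S × ℝ≥0 × ℝ → ℝ} (hGm : ∀ s a, Measurable (G s a))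
    (hG : ∀ s a, Integrable (G s a) (M.law s a)) :
    Integrable (fun ω => alive t ω n * G (stateAt s ω n) (ω n).1 (ω n).2) (M.pathLaw π s) ∧
    ∫ ω, alive t ω n * G (stateAt s ω n) (ω n).1 (ω n).2 ∂(M.pathLaw π s) =
      ∫ ω, alive t ω n * ∫ w, G (stateAt s ω n) (ω n).1 w ∂(M.law (stateAt s ω n) (ω n).1)
        ∂(M.pathLaw π s) := by
  simp only [← histAlive_histOf t s]
  refine M.integral_mul_step π s n (measurable_histAlive t n) (fun h => ?_) hGm hG
  unfold histAlive
  split_ifs <;> simp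

lemma integrable_step (π : Policy S A) (s : S) (n : ℕ)
    {G : S → A → S × ℝ≥0 × ℝ → ℝ} (hGm : ∀ s a, Measurable (G s a))
    (hG : ∀ s a, Integrable (G s a) (M.law s a)) :
    Integrable (fun ω => G (stateAt s ω n) (ω n).1 (ω n).2) (M.pathLaw π s) := by
  simpa using (M.integral_mul_step π s n (φ := fun _ => 1) measurable_const (by simp) hGm hG).1

lemma integrable_alive (π : Policy S A) (s : S) (t : ℝ) (n : ℕ) :
    Integrable (fun ω => alive t ω n) (M.pathLaw π s) :=
  Integrable.of_bound (C := 1) (by fun_prop) (ae_of_all _ fun ω => by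
    rw [Real.norm_of_nonneg (alive_nonneg t ω n)]; exact alive_le_one t ω n)

lemma integrable_alive_mul (π : Policy S A) (s : S) (t : ℝ) (n : ℕ) {X : (ℕ → Step S A) → ℝ}
    (hX : Integrable X (M.pathLaw π s)) :
    Integrable (fun ω => alive t ω n * X ω) (M.pathLaw π s) :=
  hX.bdd_mul (c := 1) (by fun_prop) (ae_of_all _ fun ω => by
    rw [Real.norm_of_nonneg (alive_nonneg t ω n)]; exact alive_le_one t ω n)

lemma integrable_state_action (π : Policy S A) (s : S) (n : ℕ) (g : S → A → ℝ) :
    Integrable (fun ω => g (stateAt s ω n) (ω n).1) (M.pathLaw π s) := by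
  have := M.isProb
  exact M.integrable_step π s n (G := fun s a _ => g s a) (fun _ _ => measurable_const)
    fun _ _ => integrable_const _

lemma integral_alive_mul_step_le (π : Policy S A) (s : S) (t : ℝ) (n : ℕ)
    {G : S → A → S × ℝ≥0 × ℝ → ℝ} (hGm : ∀ s a, Measurable (G s a))
    (hG : ∀ s a, Integrable (G s a) (M.law s a)) {c : ℝ} (hc : ∀ s a, ∫ w, G s a w ∂(M.law s a) ≤ c) :
    ∫ ω, alive t ω n * G (stateAt s ω n) (ω n).1 (ω n).2 ∂(M.pathLaw π s) ≤
      c * ∫ ω, alive t ω n ∂(M.pathLaw π s) := by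
  rw [(M.integral_alive_mul_step π s t n hGm hG).2, ← integral_const_mul]
  refine integral_mono (M.integrable_alive_mul π s t n (M.integrable_state_action π s n
    fun s a => ∫ w, G s a w ∂(M.law s a))) ((M.integrable_alive π s t n).const_mul c) fun ω => ?_
  simp only
  rw [mul_comm c]
  exact mul_le_mul_of_nonneg_left (hc _ _) (alive_nonneg t ω n)

variable {M}

/-- The expected number of transitions that start by time `t` grows at most linearly. -/
lemma ModelConditions.exists_sum_integral_alive_le (hM : M.ModelConditions) :
    ∃ c : ℝ, 0 < c ∧ ∀ (π : Policy S A) (s : S) (t : ℝ), 0 ≤ t → ∀ N : ℕ,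
      ∑ n ∈ Finset.range N, ∫ ω, alive t ω n ∂(M.pathLaw π s) ≤ c * (t + 1) := by
  obtain ⟨c, hc, hcle⟩ := hM.exists_truncated_holding_pos
  refine ⟨c⁻¹, inv_pos.2 hc, fun π s t ht N => ?_⟩
  have hGm : ∀ (_ : S) (_ : A), Measurable (fun w : S × ℝ≥0 × ℝ => -min (w.2.1 : ℝ) 1) :=
    fun _ _ => by fun_prop
  have hG : ∀ s a, Integrable (fun w : S × ℝ≥0 × ℝ => -min (w.2.1 : ℝ) 1) (M.law s a) :=
    fun s a => by
      have := M.isProb s a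
      exact ((hM.integrable_holding s a).inf (integrable_const 1)).neg
  -- Each transition begun by time t consumes at least c of truncated holding time on average, while
  -- the pathwise total is at most t + 1.
  have h1 : ∀ n, c * ∫ ω, alive t ω n ∂(M.pathLaw π s) ≤
      ∫ ω, alive t ω n * min ((ω n).2.2.1 : ℝ) 1 ∂(M.pathLaw π s) := fun n => by
    have := M.integral_alive_mul_step_le π s t n hGm hG (c := -c) (fun s a => by
      rw [integral_neg]; exact neg_le_neg (hcle s a))
    simp only [mul_neg, integral_neg] at this
    linarith
  have h2 : c * ∑ n ∈ Finset.range N, ∫ ω, alive t ω n ∂(M.pathLaw π s) ≤ t + 1 := by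
    rw [Finset.mul_sum]
    refine (Finset.sum_le_sum fun n _ => h1 n).trans ?_
    have hi : ∀ n, Integrable (fun ω => alive t ω n * min ((ω n).2.2.1 : ℝ) 1)
        (M.pathLaw π s) := fun n => by
      simpa using (M.integral_alive_mul_step π s t n hGm hG).1.neg
    rw [← integral_finsetSum _ fun n _ => hi n]
    calc _ ≤ ∫ _, (t + 1) ∂(M.pathLaw π s) :=
          integral_mono (integrable_finsetSum _ fun n _ => hi n) (integrable_const _)
            fun ω => sum_alive_mul_min_le ht ω N
      _ = t + 1 := by simp
  rw [inv_mul_eq_div, le_div_iff₀ hc, mul_comm]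
  exact h2

lemma ModelConditions.summable_integral_alive (hM : M.ModelConditions) (π : Policy S A) (s : S)
    {t : ℝ} (ht : 0 ≤ t) : Summable fun n => ∫ ω, alive t ω n ∂(M.pathLaw π s) := by
  obtain ⟨c, -, h⟩ := hM.exists_sum_integral_alive_le
  exact summable_of_sum_range_le (fun n => integral_nonneg fun ω => alive_nonneg t ω n)
    (h π s t ht)

/-- Borel–Cantelli: the probabilities that transition n starts by time t are summable. -/
lemma ModelConditions.ae_eventually_transTime_gt (hM : M.ModelConditions) (π : Policy S A) (s : S)
    {t : ℝ} (ht : 0 ≤ t) :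
    ∀ᵐ ω ∂(M.pathLaw π s), ∀ᶠ n in atTop, ¬ transTime ω n ≤ t := by
  refine ae_eventually_notMem (s := fun n => {ω | transTime ω n ≤ t}) ?_
  have hms : ∀ n, MeasurableSet {ω : ℕ → Step S A | transTime ω n ≤ t} := fun n =>
    measurableSet_le (by fun_prop) measurable_const
  have h : ∀ n, (M.pathLaw π s) {ω | transTime ω n ≤ t} =
      ENNReal.ofReal (∫ ω, alive t ω n ∂(M.pathLaw π s)) := fun n => by
    have : (fun ω : ℕ → Step S A => alive t ω n) = {ω | transTime ω n ≤ t}.indicator 1 := by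
      ext ω; simp [alive, Set.indicator_apply]
    rw [this, integral_indicator_one (hms n), ofReal_measureReal]
  simp only [h]
  exact (hM.summable_integral_alive π s ht).tsum_ofReal_ne_top

/-- The expected reward by time `t` as a sum over transitions. -/
lemma ModelConditions.hasSum_integral_totalReward (hM : M.ModelConditions) (π : Policy S A) (s : S)
    {t : ℝ} (ht : 0 ≤ t) :
    HasSum (fun n => ∫ ω, alive t ω (n + 1) * (ω n).2.2.2 ∂(M.pathLaw π s))
      (∫ ω, totalReward ω t ∂(M.pathLaw π s)) := by
  have hR : ∀ n, Integrable (fun ω : ℕ → Step S A => (ω n).2.2.2) (M.pathLaw π s) := fun n =>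
    M.integrable_step π s n (G := fun _ _ w => w.2.2) (fun _ _ => by fun_prop) hM.integrable_reward
  rw [integral_congr_ae ((hM.ae_eventually_transTime_gt π s ht).mono
    fun ω hω => totalReward_eq_tsum ht hω)]
  refine hasSum_integral_of_summable_integral_norm
    (fun n => M.integrable_alive_mul π s t (n + 1) (hR n)) ?_
  obtain ⟨c, hc⟩ : ∃ c, ∀ s a, ∫ w, |w.2.2| ∂(M.law s a) ≤ c := by
    obtain ⟨c, hc⟩ := (Set.finite_range
      fun x : S × A => ∫ w, |w.2.2| ∂(M.law x.1 x.2)).bddAbove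
    exact ⟨c, fun s a => hc ⟨(s, a), rfl⟩⟩
  refine Summable.of_nonneg_of_le (fun n => integral_nonneg fun _ => norm_nonneg _) (fun n => ?_)
    ((hM.summable_integral_alive π s ht).mul_left c)
  -- Conditioning does not apply to `alive t ω (n + 1)`, which involves the holding time of
  -- transition n itself; it is dominated by `alive t ω n`, which is known beforehand.
  refine le_trans ?_ (M.integral_alive_mul_step_le π s t n (G := fun _ _ w => |w.2.2|)
    (fun _ _ => by fun_prop) (fun s a => (hM.integrable_reward s a).abs) hc)
  refine integral_mono (M.integrable_alive_mul π s t (n + 1) (hR n)).norm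
    (M.integrable_alive_mul π s t n (hR n).abs) fun ω => ?_
  simp only [norm_mul, Real.norm_eq_abs, abs_of_nonneg (alive_nonneg t ω (n + 1))]
  exact mul_le_mul_of_nonneg_right (alive_succ_le t ω n) (abs_nonneg _)

end Expectations

section MaxQ

variable {S A : Type*} [Fintype A] [Nonempty A]

lemma le_maxQ (q : S × A → ℝ) (s : S) (a : A) : q (s, a) ≤ maxQ q s :=
  Finset.le_sup' (fun a => q (s, a)) (Finset.mem_univ a)

lemma exists_eq_maxQ (q : S × A → ℝ) (s : S) : ∃ a, q (s, a) = maxQ q s := by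
  obtain ⟨a, -, ha⟩ := Finset.exists_mem_eq_sup' (Finset.univ_nonempty (α := A))
    (fun a => q (s, a))
  exact ⟨a, ha.symm⟩

end MaxQ

/-! ### Verification: the constant of the optimality equation is the optimal rate. -/

section Verification

variable {S A : Type*} [Fintype S] [MeasurableSpace S]
  [MeasurableSingletonClass S] {M : SMDP S A}

lemma integrable_comp_fst (s : S) (a : A) (v : S → ℝ) :
    Integrable (fun w : S × ℝ≥0 × ℝ => v w.1) (M.law s a) := by
  have := M.isProb s a
  obtain ⟨B, hB⟩ := (Set.finite_range fun s => ‖v s‖).bddAbove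
  exact Integrable.of_bound (C := B)
    ((measurable_of_finite v).comp measurable_fst).aestronglyMeasurable
    (ae_of_all _ fun w => hB ⟨w.1, rfl⟩)

lemma integral_comp_fst (s : S) (a : A) (v : S → ℝ) :
    ∫ w, v w.1 ∂(M.law s a) = ∑ s', M.prob s a s' * v s' := by
  classical
  have := M.isProb s a
  have hm : ∀ s', MeasurableSet {w : S × ℝ≥0 × ℝ | w.1 = s'} := fun s' =>
    measurable_fst (measurableSet_singleton s')
  have h : (fun w : S × ℝ≥0 × ℝ => v w.1) =
      fun w => ∑ s', {w : S × ℝ≥0 × ℝ | w.1 = s'}.indicator (fun _ => v s') w := by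
    ext w
    simp [Set.indicator_apply]
  rw [h, integral_finsetSum _ fun s' _ => (integrable_const _).indicator (hm s')]
  refine Finset.sum_congr rfl fun s' _ => ?_
  rw [integral_indicator_const _ (hm s')]
  rfl

lemma integrable_increment (hM : M.ModelConditions) (s : S) (a : A) (r : ℝ) (v : S → ℝ) :
    Integrable (fun w : S × ℝ≥0 × ℝ => w.2.2 - r * (w.2.1 : ℝ) + v w.1 - v s) (M.law s a) := by
  have := M.isProb s a
  exact (((hM.integrable_reward s a).sub ((hM.integrable_holding s a).const_mul r)).add
    (integrable_comp_fst s a v)).sub (integrable_const _)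

lemma integral_increment (hM : M.ModelConditions) (s : S) (a : A) (r : ℝ) (v : S → ℝ) :
    ∫ w, (w.2.2 - r * (w.2.1 : ℝ) + v w.1 - v s) ∂(M.law s a) =
      M.reward s a - M.holding s a * r + ∑ s', M.prob s a s' * v s' - v s := by
  have := M.isProb s a
  have h1 := hM.integrable_reward s a
  have h2 := (hM.integrable_holding s a).const_mul r
  have h3 := integrable_comp_fst (M := M) s a v
  have h4 : Integrable (fun w : S × ℝ≥0 × ℝ => w.2.2 - r * (w.2.1 : ℝ)) (M.law s a) := h1.sub h2
  have h5 : Integrable (fun w : S × ℝ≥0 × ℝ => w.2.2 - r * (w.2.1 : ℝ) + v w.1) (M.law s a) :=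
    h4.add h3
  rw [integral_sub h5 (integrable_const _), integral_add h4 h3, integral_sub h1 h2, integral_const_mul, integral_comp_fst]
  simp [reward, holding, mul_comm r]

variable [Fintype A] [MeasurableSpace A] [MeasurableSingletonClass A]

/-- The expected reward by time `t` differs from `r t` plus the compensator of the increments
by at most a multiple of `√t`. -/
lemma ModelConditions.exists_abs_integral_sub_le (hM : M.ModelConditions) (r : ℝ) (v : S → ℝ) :
    ∃ B : ℝ, 0 ≤ B ∧ ∀ (π : Policy S A) (s : S) (t : ℝ), 1 ≤ t → ∀ N : ℕ,
      |∑ n ∈ Finset.range N, ∫ ω, alive t ω (n + 1) * (ω n).2.2.2 ∂(M.pathLaw π s) - r * t -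
        ∑ n ∈ Finset.range N, ∫ ω, alive t ω n *
          (M.reward (stateAt s ω n) (ω n).1 - M.holding (stateAt s ω n) (ω n).1 * r +
            ∑ s', M.prob (stateAt s ω n) (ω n).1 s' * v s' - v (stateAt s ω n))
          ∂(M.pathLaw π s)| ≤
        |r| * t * ∫ ω, alive t ω N ∂(M.pathLaw π s) + B * √t := by
  obtain ⟨V, hV⟩ := (Set.finite_range fun s => |v s|).bddAbove
  have hV' : ∀ s, |v s| ≤ V := fun s => hV ⟨s, rfl⟩
  obtain ⟨c, hc, hcle⟩ := hM.exists_sum_integral_alive_le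
  obtain ⟨D, hD⟩ := (Set.finite_range fun x : S × A =>
    ∫ w, (|r| * (w.2.1 : ℝ) ^ 2 + w.2.2 ^ 2) ∂(M.law x.1 x.2)).bddAbove
  have hD' : ∀ s a, ∫ w, (|r| * (w.2.1 : ℝ) ^ 2 + w.2.2 ^ 2) ∂(M.law s a) ≤ max D 0 :=
    fun s a => (hD ⟨(s, a), rfl⟩).trans (le_max_left _ _)
  have hsqm : ∀ (_ : S) (_ : A), Measurable
      (fun w : S × ℝ≥0 × ℝ => |r| * (w.2.1 : ℝ) ^ 2 + w.2.2 ^ 2) := fun _ _ => by fun_prop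
  have hsq : ∀ s a, Integrable
      (fun w : S × ℝ≥0 × ℝ => |r| * (w.2.1 : ℝ) ^ 2 + w.2.2 ^ 2) (M.law s a) :=
    fun s a => ((hM.holding_sq s a).const_mul _).add (hM.reward_sq s a)
  set D' := max D 0
  have hD0 : 0 ≤ D' := le_max_right _ _
  refine ⟨D' * c + (|r| + 1) / 2 + 3 * max V 0, by positivity, fun π s t ht N => ?_⟩
  have ht0 : 0 ≤ t := zero_le_one.trans ht
  -- The parameter K of the pathwise estimate is taken to be √t, balancing the O(t)/K from the
  -- second moments against the O(K) remainder.
  have hK : 0 < √t := Real.sqrt_pos.2 (by linarith)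
  have hK1 : 1 ≤ √t := Real.one_le_sqrt.2 ht
  have hKK : √t * √t = t := Real.mul_self_sqrt ht0
  have hR : ∀ n, Integrable (fun ω : ℕ → Step S A => (ω n).2.2.2) (M.pathLaw π s) := fun n =>
    M.integrable_step π s n (G := fun _ _ w => w.2.2) (fun _ _ => by fun_prop) hM.integrable_reward
  have hRi := fun n => M.integrable_alive_mul π s t (n + 1) (hR n)
  have hgm : ∀ (s : S) (_ : A), Measurable
      (fun w : S × ℝ≥0 × ℝ => w.2.2 - r * (w.2.1 : ℝ) + v w.1 - v s) := fun s _ => by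
    have : Measurable fun w : S × ℝ≥0 × ℝ => v w.1 := (measurable_of_finite v).comp measurable_fst
    have h2 : Measurable fun w : S × ℝ≥0 × ℝ => w.2.2 - r * (w.2.1 : ℝ) := by fun_prop
    exact (h2.add this).sub_const _
  have hg := fun n => M.integral_alive_mul_step π s t n hgm
    fun s a => integrable_increment hM s a r v
  have hq := fun n => M.integral_alive_mul_step π s t n hsqm hsq
  -- As `alive t ω n` is determined by the history, the increment may be replaced by its conditional
  -- mean.
  have hΓ : ∀ n, ∫ ω, alive t ω n *
          (M.reward (stateAt s ω n) (ω n).1 - M.holding (stateAt s ω n) (ω n).1 * r +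
            ∑ s', M.prob (stateAt s ω n) (ω n).1 s' * v s' - v (stateAt s ω n))
          ∂(M.pathLaw π s) = ∫ ω, alive t ω n * ((ω n).2.2.2 - r * ((ω n).2.2.1 : ℝ) +
            v (stateAt s ω (n + 1)) - v (stateAt s ω n)) ∂(M.pathLaw π s) := fun n => by
    refine Eq.trans ?_ (hg n).2.symm
    simp only [integral_increment hM]
  have hgi : ∀ n, Integrable (fun ω => alive t ω n * ((ω n).2.2.2 - r * ((ω n).2.2.1 : ℝ) +
            v (stateAt s ω (n + 1)) - v (stateAt s ω n))) (M.pathLaw π s) := fun n => (hg n).1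
  simp only [hΓ]
  rw [← integral_finsetSum _ fun n _ => hRi n, ← integral_finsetSum _ fun n _ => hgi n]
  have hs1 : Integrable (fun ω => ∑ n ∈ Finset.range N, alive t ω (n + 1) * (ω n).2.2.2)
    (M.pathLaw π s) := integrable_finsetSum _ fun n _ => hRi n
  have hs2 : Integrable (fun ω => ∑ n ∈ Finset.range N, alive t ω n *
      ((ω n).2.2.2 - r * ((ω n).2.2.1 : ℝ) + v (stateAt s ω (n + 1)) - v (stateAt s ω n)))
    (M.pathLaw π s) := integrable_finsetSum _ fun n _ => hgi n
  have hs3 : Integrable (fun ω => ∑ n ∈ Finset.range N, alive t ω n *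
      (|r| * ((ω n).2.2.1 : ℝ) ^ 2 + (ω n).2.2.2 ^ 2))
    (M.pathLaw π s) := integrable_finsetSum _ fun n _ => (hq n).1
  have hconst : ∫ _, r * t ∂(M.pathLaw π s) = r * t := by simp
  have hs4 : Integrable (fun ω => ∑ n ∈ Finset.range N, alive t ω (n + 1) * (ω n).2.2.2 - r * t)
    (M.pathLaw π s) := hs1.sub (integrable_const _)
  rw [← hconst, ← integral_sub hs1 (integrable_const _), ← integral_sub hs4 hs2]
  refine abs_integral_le_integral_abs.trans ?_
  refine (integral_mono (hs4.sub hs2).abs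
    ((((M.integrable_alive π s t N).const_mul (|r| * t)).add (hs3.const_mul (1 / (2 * √t)))).add
      (integrable_const ((|r| + 1) * √t / 2 + 3 * max V 0)))
    fun ω => abs_sum_reward_sub_le ht0 s ω (fun s => (hV' s).trans (le_max_left V 0)) r hK N).trans ?_
  rw [integral_add' (((M.integrable_alive π s t N).const_mul (|r| * t)).add
    (hs3.const_mul (1 / (2 * √t)))) (integrable_const _),
    integral_add' ((M.integrable_alive π s t N).const_mul (|r| * t)) (hs3.const_mul (1 / (2 * √t))),
    integral_const_mul, integral_const_mul, integral_finsetSum _ fun n _ => (hq n).1]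
  have h1 : ∑ n ∈ Finset.range N, ∫ ω, alive t ω n *
      (|r| * ((ω n).2.2.1 : ℝ) ^ 2 + (ω n).2.2.2 ^ 2) ∂(M.pathLaw π s) ≤ D' * (c * (t + 1)) := by
    refine (Finset.sum_le_sum fun n _ => M.integral_alive_mul_step_le π s t n hsqm hsq hD').trans ?_
    rw [← Finset.mul_sum]
    exact mul_le_mul_of_nonneg_left (hcle π s t ht0 N) hD0
  have h2 : 1 / (2 * √t) * (D' * (c * (t + 1))) ≤ D' * c * √t := by
    rw [div_mul_eq_mul_div, one_mul, div_le_iff₀ (by positivity)]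
    have : D' * (c * (t + 1)) ≤ D' * (c * (2 * t)) := by gcongr; linarith
    refine this.trans (le_of_eq ?_)
    linear_combination (-(2 * D' * c)) * hKK
  have h3 := mul_le_mul_of_nonneg_left h1 (by positivity : 0 ≤ 1 / (2 * √t))
  have h4 : 3 * max V 0 ≤ 3 * max V 0 * √t := by
    have : 0 ≤ 3 * max V 0 := by positivity
    nlinarith
  simp only [integral_const, probReal_univ, one_smul]
  linarith

variable [Nonempty A]

/-- With v = `maxQ q` the conditional mean increment is q(s,a) - v(s): nonpositive for every action,
zero for the greedy one. The number N of transitions is then sent to infinity at fixed t. -/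
lemma ModelConditions.exists_integral_totalReward_bounds (hM : M.ModelConditions) {r : ℝ}
    {q : S × A → ℝ} (hq : M.SolvesAOE r q) {σ : S → A} (hσ : ∀ s, q (s, σ s) = maxQ q s) :
    ∃ B : ℝ, 0 ≤ B ∧
      (∀ (π : Policy S A) (s : S) (t : ℝ), 1 ≤ t →
        ∫ ω, totalReward ω t ∂(M.pathLaw π s) ≤ r * t + B * √t) ∧
      (∀ (s : S) (t : ℝ), 1 ≤ t →
        r * t - B * √t ≤ ∫ ω, totalReward ω t ∂(M.pathLaw (stationaryPolicy σ) s)) := by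
  obtain ⟨B, hB, h⟩ := hM.exists_abs_integral_sub_le (A := A) r (maxQ q)
  simp only [← hq _ _] at h
  have hlim : ∀ (π : Policy S A) (s : S) (t : ℝ), 1 ≤ t → Tendsto (fun N =>
      |r| * t * ∫ ω, alive t ω N ∂(M.pathLaw π s) + B * √t) atTop (𝓝 (B * √t)) := by
    intro π s t ht
    have := ((hM.summable_integral_alive π s
      (zero_le_one.trans ht)).tendsto_atTop_zero.const_mul (|r| * t)).add_const (B * √t)
    simpa using this
  refine ⟨B, hB, fun π s t ht => ?_, fun s t ht => ?_⟩
  · have hs := (hM.hasSum_integral_totalReward π s (zero_le_one.trans ht)).tendsto_sum_nat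
    refine le_of_tendsto_of_tendsto' hs ((hlim π s t ht).const_add (r * t)) fun N => ?_
    have h1 := (abs_le.1 (h π s t ht N)).2
    have h2 : ∑ n ∈ Finset.range N, ∫ ω, alive t ω n * (q (stateAt s ω n, (ω n).1) -
        maxQ q (stateAt s ω n)) ∂(M.pathLaw π s) ≤ 0 :=
      Finset.sum_nonpos fun n _ => integral_nonpos fun ω =>
        mul_nonpos_of_nonneg_of_nonpos (alive_nonneg t ω n) (sub_nonpos.2 (le_maxQ q _ _))
    linarith
  · have hs := (hM.hasSum_integral_totalReward (stationaryPolicy σ) s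
      (zero_le_one.trans ht)).tendsto_sum_nat
    refine le_of_tendsto_of_tendsto' ((hlim (stationaryPolicy σ) s t ht).const_sub (r * t)) hs
      fun N => ?_
    have h1 := (abs_le.1 (h (stationaryPolicy σ) s t ht N)).1
    have h2 : ∑ n ∈ Finset.range N, ∫ ω, alive t ω n * (q (stateAt s ω n, (ω n).1) -
        maxQ q (stateAt s ω n)) ∂(M.pathLaw (stationaryPolicy σ) s) = 0 := by
      refine Finset.sum_eq_zero fun n _ => integral_eq_zero_of_ae ?_
      filter_upwards [M.ae_action_stationaryPolicy σ s n] with ω hω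
      simp [hω, hσ]
    linarith

lemma tendsto_inv_mul_add_sqrt (r B : ℝ) :
    Tendsto (fun t : ℝ => ((t⁻¹ * (r * t + B * √t) : ℝ) : EReal)) atTop (𝓝 (r : EReal)) := by
  refine (continuous_coe_real_ereal.tendsto r).comp ?_
  have h : Tendsto (fun t : ℝ => r + B * (√t)⁻¹) atTop (𝓝 (r + B * 0)) :=
    ((tendsto_inv_atTop_zero.comp Real.tendsto_sqrt_atTop).const_mul B).const_add r
  rw [mul_zero, add_zero] at h
  refine h.congr' ?_
  filter_upwards [eventually_gt_atTop 0] with t ht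
  have hK : 0 < √t := Real.sqrt_pos.2 ht
  have hKK : √t * √t = t := Real.mul_self_sqrt ht.le
  field_simp
  linear_combination (-B) * hKK

/-- Verification: the constant in the average-reward optimality equation is the optimal reward
rate. -/
theorem ModelConditions.optReward_eq (hM : M.ModelConditions) {r : ℝ} {q : S × A → ℝ}
    (hq : M.SolvesAOE r q) (s : S) : M.optReward s = (r : EReal) := by
  choose σ hσ using exists_eq_maxQ q
  obtain ⟨B, hB, hup, hlo⟩ := hM.exists_integral_totalReward_bounds hq hσ
  refine le_antisymm (iSup_le fun π => ?_) ?_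
  · unfold avgReward
    rw [← (tendsto_inv_mul_add_sqrt r B).liminf_eq]
    refine liminf_le_liminf ?_
    filter_upwards [eventually_ge_atTop 1] with t ht
    have : 0 ≤ t⁻¹ := by positivity
    exact_mod_cast mul_le_mul_of_nonneg_left (hup π s t ht) this
  · refine le_trans ?_ (le_iSup _ (stationaryPolicy σ))
    unfold avgReward
    rw [← (tendsto_inv_mul_add_sqrt r (-B)).liminf_eq]
    refine liminf_le_liminf ?_
    filter_upwards [eventually_ge_atTop 1] with t ht
    have h0 : 0 ≤ t⁻¹ := by positivity
    have h1 := hlo s t ht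
    have h2 : r * t + -B * √t ≤ ∫ ω, totalReward ω t ∂(M.pathLaw (stationaryPolicy σ) s) := by
      linarith
    exact_mod_cast mul_le_mul_of_nonneg_left h2 h0

end Verification

lemma prob_nonneg {S A : Type*} [MeasurableSpace S] (M : SMDP S A) (s : S) (a : A) (s' : S) :
    0 ≤ M.prob s a s' := measureReal_nonneg

/-! ### Consequences of weak communication. -/

section Communication

variable {S A : Type*} [Fintype S] [MeasurableSpace S]
  [MeasurableSingletonClass S] (M : SMDP S A)

lemma sum_prob (s : S) (a : A) : ∑ s', M.prob s a s' = 1 := by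
  have := M.isProb s a
  have h := integral_comp_fst (M := M) s a (fun _ => 1)
  simpa using h.symm

/-- If an average of `v` is at most a lower bound of `v`, then `v` equals that bound at every state
of positive probability. -/
lemma eq_of_sum_prob_mul_le {s : S} {a : A} {v : S → ℝ} {m : ℝ} (hm : ∀ s', m ≤ v s')
    (h : ∑ s', M.prob s a s' * v s' ≤ m) {s' : S} (hs' : v s' ≠ m) : M.prob s a s' = 0 := by
  have h1 : ∑ s', M.prob s a s' * (v s' - m) ≤ 0 := by
    simp only [mul_sub, Finset.sum_sub_distrib]
    rw [← Finset.sum_mul, M.sum_prob]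
    linarith
  have hnn : ∀ s' ∈ Finset.univ, 0 ≤ M.prob s a s' * (v s' - m) := fun s' _ =>
    mul_nonneg (M.prob_nonneg s a s') (sub_nonneg.2 (hm s'))
  have h2 := (Finset.sum_eq_zero_iff_of_nonneg hnn).1 (le_antisymm h1 (Finset.sum_nonneg hnn)) s'
    (Finset.mem_univ _)
  exact (mul_eq_zero.1 h2).resolve_right (sub_ne_zero.2 hs')

variable [Fintype A] [MeasurableSpace A] [MeasurableSingletonClass A] {M}

/-- A set of states that is closed under all actions and meets a communicating class contains it. -/
lemma IsClosedCommClass.subset_of_closed {C : Set S} (hC : M.IsClosedCommClass C) {D : Set S}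
    (hD : ∀ s ∈ D, ∀ a, ∀ s' ∉ D, M.prob s a s' = 0) {s : S} (hsC : s ∈ C) (hsD : s ∈ D) :
    C ⊆ D := by
  intro s' hs'
  obtain ⟨π, hπ⟩ := hC.reachable s hsC s' hs'
  have h := M.ae_stateAt_mem π D hsD fun n => ae_of_all _ fun ω hω => hD _ hω _
  by_contra hc
  refine hπ.ne' (measure_mono_null ?_ h)
  rintro ω ⟨n, hn⟩ hω
  exact hc (hn ▸ hω n)

/-- A nonempty set of states that is closed under some decision rule contains a non-transient
state. -/
lemma exists_mem_of_forall_isTransientState {C D : Set S} (hC : ∀ s ∉ C, M.IsTransientState s)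
    (hD : D.Nonempty) (σ : S → A) (hσ : ∀ s ∈ D, ∀ s' ∉ D, M.prob s (σ s) s' = 0) :
    ∃ s ∈ D, s ∈ C := by
  by_contra! hc
  obtain ⟨s, hs⟩ := hD
  have h1 := M.ae_stateAt_mem (stationaryPolicy σ) D hs fun n =>
    (M.ae_action_stationaryPolicy σ s n).mono fun ω hω hd => hω ▸ hσ _ hd
  have h2 : ∀ᵐ ω ∂(M.pathLaw (stationaryPolicy σ) s), ∀ d, d ∈ D →
      ¬ ∃ᶠ n in atTop, stateAt s ω n = d := by
    rw [ae_all_iff]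
    intro d
    by_cases hd : d ∈ D
    · refine (measure_eq_zero_iff_ae_notMem.1 (hC d (hc d hd) (stationaryPolicy σ) s)).mono ?_
      exact fun ω hω _ => hω
    · exact ae_of_all _ fun ω h => absurd h hd
  obtain ⟨ω, hω1, hω2⟩ := (h1.and h2).exists
  -- The state space being finite, leaving each state for good would eventually leave no state to
  -- occupy.
  have h3 : ∀ᶠ n in atTop, ∀ d, stateAt s ω n ≠ d := by
    rw [eventually_all]
    intro d
    by_cases hd : d ∈ D
    · exact not_frequently.1 (hω2 d hd)
    · exact Eventually.of_forall fun n hn => hd (hn ▸ hω1 n)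
  obtain ⟨n, hn⟩ := h3.exists
  exact hn _ rfl

/-- In a weakly communicating model, the solutions of the optimality equation with zero rewards
are constant. -/
theorem WeaklyCommunicating.eq_of_optimality [Nonempty A] (hW : M.WeaklyCommunicating) {v : S → ℝ}
    (hle : ∀ s a, ∑ s', M.prob s a s' * v s' ≤ v s)
    (hex : ∀ s, ∃ a, v s ≤ ∑ s', M.prob s a s' * v s') (s₁ s₂ : S) : v s₁ = v s₂ := by
  obtain ⟨C, hC, -, htr⟩ := hW
  have : Nonempty S := ⟨s₁⟩
  obtain ⟨lo, hlo⟩ := Finite.exists_min v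
  obtain ⟨hi, hhi⟩ := Finite.exists_max v
  -- The minimisers of v are closed under every action, hence contain a point of C and so all of C.
  have hE : ∀ s ∈ {s | v s = v lo}, ∀ a, ∀ s' ∉ {s | v s = v lo}, M.prob s a s' = 0 := by
    intro s hs a s' hs'
    exact M.eq_of_sum_prob_mul_le hlo ((hle s a).trans hs.le) hs'
  obtain ⟨s₀, hs₀, hs₀C⟩ := exists_mem_of_forall_isTransientState htr
    (D := {s | v s = v lo}) ⟨lo, rfl⟩
    (fun _ => Classical.arbitrary A) (fun s hs => hE s hs _)
  have hCE := hC.subset_of_closed hE hs₀C hs₀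
  choose σ hσ using hex
  -- The maximisers are closed only under the rule σ. That still gives one point of C among them,
  -- which is also a minimiser, so max v = min v.
  have hF : ∀ s ∈ {s | v s = v hi}, ∀ s' ∉ {s | v s = v hi}, M.prob s (σ s) s' = 0 := by
    intro s hs s' hs'
    refine M.eq_of_sum_prob_mul_le (v := fun s => -v s) (m := -v hi) (fun s => neg_le_neg (hhi s))
      ?_ fun h => hs' (neg_injective h)
    simp only [mul_neg, Finset.sum_neg_distrib]
    exact neg_le_neg (hs ▸ hσ s)
  obtain ⟨s₃, hs₃, hs₃C⟩ := exists_mem_of_forall_isTransientState htr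
    (D := {s | v s = v hi}) ⟨hi, rfl⟩ σ hF
  have heq : v hi = v lo := (Eq.symm hs₃).trans (hCE hs₃C)
  have hconst : ∀ s, v s = v lo := fun s => le_antisymm (heq ▸ hhi s) (hlo s)
  rw [hconst s₁, hconst s₂]

end Communication

/-! ### The maximum over actions: Lipschitz bound, translation, homogeneity. -/

section MaxQProperties

variable {S A : Type*} [Fintype A] [Nonempty A]

lemma maxQ_le_add_norm [Fintype S] (q q' : S × A → ℝ) (s : S) : maxQ q s ≤ maxQ q' s + ‖q - q'‖ := by
  refine Finset.sup'_le _ _ fun a _ => ?_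
  have h1 := norm_le_pi_norm (q - q') (s, a)
  have h2 := le_maxQ q' s a
  rw [Pi.sub_apply, Real.norm_eq_abs] at h1
  linarith [(abs_le.1 h1).2]

lemma abs_maxQ_sub_le [Fintype S] (q q' : S × A → ℝ) (s : S) : |maxQ q s - maxQ q' s| ≤ ‖q - q'‖ := by
  rw [abs_le]
  have h1 := maxQ_le_add_norm q q' s
  have h2 := maxQ_le_add_norm q' q s
  rw [norm_sub_rev] at h2
  constructor <;> linarith

lemma maxQ_add_const (q : S × A → ℝ) (c : ℝ) (s : S) :
    maxQ (fun x => q x + c) s = maxQ q s + c := by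
  obtain ⟨a, ha⟩ := exists_eq_maxQ q s
  refine le_antisymm (Finset.sup'_le _ _ fun a _ => ?_) ?_
  · linarith [le_maxQ q s a]
  · rw [← ha]; exact le_maxQ (fun x => q x + c) s a

lemma maxQ_smul {c : ℝ} (hc : 0 ≤ c) (q : S × A → ℝ) (s : S) : maxQ (c • q) s = c * maxQ q s := by
  obtain ⟨a, ha⟩ := exists_eq_maxQ q s
  refine le_antisymm (Finset.sup'_le _ _ fun a _ => ?_) ?_
  · exact mul_le_mul_of_nonneg_left (le_maxQ q s a) hc
  · rw [← ha]; exact le_maxQ (c • q) s a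

lemma maxQ_zero (s : S) : maxQ (0 : S × A → ℝ) s = 0 := by
  simpa using maxQ_smul le_rfl (0 : S × A → ℝ) s

end MaxQProperties

/-! ### The dynamic programming operator and solvability of the optimality equation. -/

section Operator

variable {S A : Type*} [Fintype S] [Fintype A] [Nonempty A] [MeasurableSpace S]
  {M : SMDP S A} {α : ℝ}

lemma dpOperator_sub_self (hα : 0 < α) (hα' : ∀ s a, α ≤ M.holding s a) (q : S × A → ℝ)
    (x : S × A) : M.dpOperator α q x - q x = α / M.holding x.1 x.2 *
      (M.reward x.1 x.2 + ∑ s', M.prob x.1 x.2 s' * maxQ q s' - q x) := by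
  have : 0 < M.holding x.1 x.2 := hα.trans_le (hα' _ _)
  unfold dpOperator
  field_simp
  ring

lemma dpOperator_sub_self_eq_iff (hα : 0 < α) (hα' : ∀ s a, α ≤ M.holding s a) (q : S × A → ℝ)
    (r : ℝ) : (∀ x, M.dpOperator α q x - q x = α * r) ↔ M.SolvesAOE r q := by
  have key : ∀ x : S × A, M.dpOperator α q x - q x = α * r ↔
      q x = M.reward x.1 x.2 - M.holding x.1 x.2 * r + ∑ s', M.prob x.1 x.2 s' * maxQ q s' := by
    intro x
    have ht : 0 < M.holding x.1 x.2 := hα.trans_le (hα' _ _)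
    rw [dpOperator_sub_self hα hα', div_mul_eq_mul_div, div_eq_iff ht.ne', mul_assoc,
      mul_right_inj' hα.ne']
    constructor <;> intro h <;> linarith
  simp only [key]
  exact Prod.forall

lemma rviField_eq_zero_iff (hα : 0 < α) (hα' : ∀ s a, α ≤ M.holding s a)
    (f : (S × A → ℝ) → ℝ) (q : S × A → ℝ) :
    M.rviField α f q = 0 ↔ M.SolvesAOE (f q) q := by
  rw [← dpOperator_sub_self_eq_iff hα hα', funext_iff]
  exact forall_congr' fun x => sub_eq_zero

/-- Subtracting `dpOperator α 0` removes the rewards, and what remains is positively homogeneous. -/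
lemma dpOperator_smul_sub_zero {c : ℝ} (hc : 0 ≤ c) (q : S × A → ℝ) :
    M.dpOperator α (c • q) - M.dpOperator α 0 = c • (M.dpOperator α q - M.dpOperator α 0) := by
  ext x
  simp only [dpOperator, Pi.sub_apply, Pi.smul_apply, smul_eq_mul, maxQ_smul hc, maxQ_zero,
    Pi.zero_apply, mul_left_comm _ c, ← Finset.mul_sum, mul_zero, Finset.sum_const_zero]
  ring

variable [MeasurableSingletonClass S]

lemma dpOperator_add_const (q : S × A → ℝ) (c : ℝ) :
    M.dpOperator α (fun x => q x + c) = fun x => M.dpOperator α q x + c := by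
  ext x
  simp only [dpOperator, maxQ_add_const, mul_add, Finset.sum_add_distrib]
  rw [← Finset.sum_mul, M.sum_prob]
  ring

/-- Since α ≤ t_{sa}, the weight α / t_{sa} lies in [0, 1], and the difference is a convex
combination of an averaged difference of maxima and q - q'. -/
lemma norm_dpOperator_sub_le (hα : 0 < α) (hα' : ∀ s a, α ≤ M.holding s a) (q q' : S × A → ℝ) :
    ‖M.dpOperator α q - M.dpOperator α q'‖ ≤ ‖q - q'‖ := by
  rw [pi_norm_le_iff_of_nonneg (norm_nonneg _)]
  intro x
  have ht : 0 < M.holding x.1 x.2 := hα.trans_le (hα' _ _)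
  set β := α / M.holding x.1 x.2 with hβ
  have hβ0 : 0 ≤ β := by positivity
  have hβ1 : β ≤ 1 := (div_le_one ht).2 (hα' _ _)
  have h1 : |∑ s', M.prob x.1 x.2 s' * (maxQ q s' - maxQ q' s')| ≤ ‖q - q'‖ := by
    refine (Finset.abs_sum_le_sum_abs _ _).trans ?_
    calc _ ≤ ∑ s', M.prob x.1 x.2 s' * ‖q - q'‖ := Finset.sum_le_sum fun s' _ => by
          rw [abs_mul, abs_of_nonneg (M.prob_nonneg _ _ _)]
          exact mul_le_mul_of_nonneg_left (abs_maxQ_sub_le q q' s') (M.prob_nonneg _ _ _)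
      _ = ‖q - q'‖ := by rw [← Finset.sum_mul, M.sum_prob, one_mul]
  have h2 : |q x - q' x| ≤ ‖q - q'‖ := norm_le_pi_norm (q - q') x
  have h3 : (M.dpOperator α q - M.dpOperator α q') x =
      β * ∑ s', M.prob x.1 x.2 s' * (maxQ q s' - maxQ q' s') + (1 - β) * (q x - q' x) := by
    simp only [Pi.sub_apply, dpOperator, mul_sub, Finset.sum_sub_distrib]
    ring
  rw [h3, Real.norm_eq_abs]
  calc _ ≤ β * ‖q - q'‖ + (1 - β) * ‖q - q'‖ := by
        refine (abs_add_le _ _).trans (add_le_add ?_ ?_)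
        · rw [abs_mul, abs_of_nonneg hβ0]
          exact mul_le_mul_of_nonneg_left h1 hβ0
        · rw [abs_mul, abs_of_nonneg (sub_nonneg.2 hβ1)]
          exact mul_le_mul_of_nonneg_left h2 (sub_nonneg.2 hβ1)
    _ = ‖q - q'‖ := by ring

lemma continuous_dpOperator (hα : 0 < α) (hα' : ∀ s a, α ≤ M.holding s a) :
    Continuous (M.dpOperator α) :=
  (LipschitzWith.of_dist_le_mul (K := 1) fun q q' => by
    rw [dist_eq_norm, dist_eq_norm, NNReal.coe_one, one_mul]
    exact norm_dpOperator_sub_le hα hα' q q').continuous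

lemma solvesAOE_add_const {r : ℝ} {q : S × A → ℝ} (hq : M.SolvesAOE r q) (c : ℝ) :
    M.SolvesAOE r (fun x => q x + c) := by
  intro s a
  simp only [maxQ_add_const, mul_add, Finset.sum_add_distrib]
  rw [← Finset.sum_mul, M.sum_prob, hq s a]
  ring

lemma norm_sub_const_dpOperator_le (hα : 0 < α) (hα' : ∀ s a, α ≤ M.holding s a) (c : ℝ)
    (p q : S × A → ℝ) :
    ‖(fun x => M.dpOperator α p x - c) - fun x => M.dpOperator α q x - c‖ ≤ ‖p - q‖ := by
  refine le_trans (le_of_eq ?_) (norm_dpOperator_sub_le hα hα' p q)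
  congr 1
  ext x
  simp

variable [MeasurableSpace A] [MeasurableSingletonClass A]

/-- In a weakly communicating model, functions with bounded residual have bounded span. -/
lemma WeaklyCommunicating.exists_norm_sub_le (hW : M.WeaklyCommunicating) (hα : 0 < α)
    (hα' : ∀ s a, α ≤ M.holding s a) (x₀ : S × A) (D : ℝ) :
    ∃ B : ℝ, 0 ≤ B ∧ ∀ q : S × A → ℝ, ‖M.dpOperator α q - q‖ ≤ D → ‖fun x => q x - q x₀‖ ≤ B := by
  set T₀ : (S × A → ℝ) → S × A → ℝ := fun q => M.dpOperator α q - M.dpOperator α 0 with hT₀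
  have hcont : Continuous fun y => ‖T₀ y - y‖ :=
    (((continuous_dpOperator hα hα').sub continuous_const).sub continuous_id).norm
  -- On this compact normalised set the zero-reward residual is bounded below by some m > 0;
  -- homogeneity carries the bound to every q vanishing at x₀.
  set K : Set (S × A → ℝ) := Metric.sphere 0 1 ∩ {y | y x₀ = 0} with hK
  have hKc : IsCompact K := (isCompact_sphere 0 1).inter_right
    (isClosed_eq (continuous_apply x₀) continuous_const)
  have hpos : ∀ y ∈ K, 0 < ‖T₀ y - y‖ := by
    rintro y ⟨hy1, hy0⟩
    refine norm_pos_iff.2 fun h => ?_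
    have hy : ∀ s a, y (s, a) = ∑ s', M.prob s a s' * maxQ y s' := by
      intro s a
      have h1 := congrFun h (s, a)
      have h2 := dpOperator_sub_self hα hα' y (s, a)
      have h3 := dpOperator_sub_self hα hα' (0 : S × A → ℝ) (s, a)
      simp only [hT₀, Pi.sub_apply, Pi.zero_apply, maxQ_zero, mul_zero, Finset.sum_const_zero,
        sub_zero, add_zero] at h1 h2 h3
      have ht : 0 < α / M.holding s a := div_pos hα (hα.trans_le (hα' _ _))
      have h4 : α / M.holding s a * (∑ s', M.prob s a s' * maxQ y s' - y (s, a)) = 0 := by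
        linear_combination h1 - h2 + h3
      linarith [(mul_eq_zero.1 h4).resolve_left ht.ne']
    -- A zero residual makes `maxQ y` constant, hence y constant; as y vanishes at x₀ it is 0, not a
    -- unit vector.
    have hconst := hW.eq_of_optimality (v := maxQ y) (fun s a => hy s a ▸ le_maxQ y s a)
      (fun s => (exists_eq_maxQ y s).imp fun a ha => (ha.symm.trans (hy s a)).le)
    have hyc : ∀ x, y x = maxQ y x₀.1 := fun x => by
      have := hy x.1 x.2
      simp only [fun s' => hconst s' x₀.1] at this
      rw [← Finset.sum_mul, M.sum_prob, one_mul] at this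
      exact this
    have hz : y = 0 := by
      ext x
      rw [hyc x, ← hyc x₀]
      exact hy0
    rw [hz] at hy1
    simp at hy1
  obtain ⟨m, hm, hmle⟩ : ∃ m : ℝ, 0 < m ∧ ∀ y ∈ K, m ≤ ‖T₀ y - y‖ := by
    rcases K.eq_empty_or_nonempty with h | h
    · exact ⟨1, one_pos, fun y hy => by rw [h] at hy; exact hy.elim⟩
    · obtain ⟨y, hy, hmin⟩ := hKc.exists_isMinOn h hcont.continuousOn
      exact ⟨_, hpos y hy, fun z hz => hmin hz⟩
  refine ⟨max ((D + ‖M.dpOperator α 0‖) / m) 0, le_max_right _ _, fun q hq => ?_⟩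
  set w : S × A → ℝ := fun x => q x - q x₀ with hw
  have hres : M.dpOperator α w - w = M.dpOperator α q - q := by
    have : w = fun x => q x + -q x₀ := by ext x; simp [hw, sub_eq_add_neg]
    rw [this, dpOperator_add_const]
    ext x
    simp
  rcases eq_or_ne w 0 with h0 | h0
  · rw [h0, norm_zero]; exact le_max_right _ _
  refine le_trans ?_ (le_max_left _ _)
  have hn : 0 < ‖w‖ := norm_pos_iff.2 h0
  have hyK : ‖w‖⁻¹ • w ∈ K := by
    refine ⟨?_, ?_⟩
    · rw [mem_sphere_zero_iff_norm, norm_smul, norm_inv, norm_norm, inv_mul_cancel₀ hn.ne']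
    · simp [hw]
  have h1 := hmle _ hyK
  have h2 : T₀ (‖w‖⁻¹ • w) - ‖w‖⁻¹ • w = ‖w‖⁻¹ • (T₀ w - w) := by
    simp only [hT₀]
    rw [dpOperator_smul_sub_zero (inv_nonneg.2 hn.le), ← smul_sub]
  rw [h2, norm_smul, norm_inv, norm_norm, inv_mul_eq_div, le_div_iff₀ hn] at h1
  rw [le_div_iff₀ hm, mul_comm]
  refine h1.trans ?_
  have h3 : T₀ w - w = (M.dpOperator α q - q) - M.dpOperator α 0 := by
    rw [← hres]
    ext x
    simp only [hT₀, Pi.sub_apply]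
    ring
  rw [h3]
  exact (norm_sub_le _ _).trans (add_le_add_left hq _)

/-- The average-reward optimality equation of a weakly communicating model has a solution. -/
theorem WeaklyCommunicating.exists_solvesAOE [Nonempty S] (hW : M.WeaklyCommunicating) (hα : 0 < α)
    (hα' : ∀ s a, α ≤ M.holding s a) : ∃ r q, M.SolvesAOE r q := by
  obtain ⟨x₀⟩ : Nonempty (S × A) := inferInstance
  set T := M.dpOperator α
  obtain ⟨B, hB0, hB⟩ := hW.exists_norm_sub_le hα hα' x₀ ‖T 0‖
  set g : (S × A → ℝ) × ℝ → ℝ := fun p => ‖fun x => T p.1 x - p.1 x - p.2‖ with hg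
  have hTc : Continuous T := continuous_dpOperator hα hα'
  have hgc : Continuous g := by
    refine Continuous.norm (continuous_pi fun x => ?_)
    exact (((continuous_apply x).comp (hTc.comp continuous_fst)).sub
      ((continuous_apply x).comp continuous_fst)).sub continuous_snd
  -- A minimiser of the residual over a compact set is fixed once and for all; discounted fixed
  -- points in that set will show that the minimum is 0, so no subsequence is needed.
  obtain ⟨p, -, hp⟩ := ((isCompact_closedBall (0 : S × A → ℝ) B).prod
    (isCompact_closedBall (0 : ℝ) ‖T 0‖)).exists_isMinOn
    ⟨(0, 0), by simp [hB0]⟩ hgc.continuousOn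
  have hsmall : ∀ ε : ℝ, 0 < ε → ε ≤ 1 / 2 → g p ≤ ε * (2 * B) := by
    intro ε hε hε'
    set γ : ℝ := 1 - ε with hγ
    have hγ0 : 0 ≤ γ := by linarith
    have hcontr : ContractingWith γ.toNNReal fun q => T (γ • q) := by
      refine ⟨by simp [hγ, hε], LipschitzWith.of_dist_le_mul fun q q' => ?_⟩
      rw [dist_eq_norm, dist_eq_norm, Real.coe_toNNReal _ hγ0]
      refine (norm_dpOperator_sub_le hα hα' _ _).trans ?_
      rw [← smul_sub, norm_smul, Real.norm_of_nonneg hγ0]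
    set q := hcontr.fixedPoint with hq
    have hfix : T (γ • q) = q := hcontr.fixedPoint_isFixedPt
    have hqn : ε * ‖q‖ ≤ ‖T 0‖ := by
      have h1 : ‖q‖ ≤ ‖T (γ • q) - T 0‖ + ‖T 0‖ := by
        conv_lhs => rw [← hfix]
        exact norm_le_norm_sub_add _ _
      have h2 := norm_dpOperator_sub_le hα hα' (γ • q) 0
      rw [sub_zero, norm_smul, Real.norm_of_nonneg hγ0] at h2
      have : ‖q‖ ≤ γ * ‖q‖ + ‖T 0‖ := h1.trans (add_le_add_left h2 _)
      rw [hγ] at this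
      linarith
    -- The residual at γq has norm ε‖q‖ ≤ ‖T 0‖ for every ε, so the span bound B applies uniformly.
    -- After normalisation the residual is ε(q - q x₀) = εγ⁻¹w, with γ⁻¹ ≤ 2.
    have hres : T (γ • q) - γ • q = ε • q := by
      rw [hfix, hγ, sub_smul, one_smul]; abel
    have hw := hB (γ • q) (by
      change ‖T (γ • q) - γ • q‖ ≤ _
      rw [hres, norm_smul, Real.norm_of_nonneg hε.le]; exact hqn)
    set w : S × A → ℝ := fun x => (γ • q) x - (γ • q) x₀ with hwdef
    have hwq : (fun x => q x - q x₀) = γ⁻¹ • w := by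
      have : γ ≠ 0 := by linarith
      ext x
      simp only [hwdef, Pi.smul_apply, smul_eq_mul]
      field_simp
    have hmem : (w, ε * q x₀) ∈ Metric.closedBall (0 : S × A → ℝ) B ×ˢ
        Metric.closedBall (0 : ℝ) ‖T 0‖ := by
      refine ⟨by simpa using hw, ?_⟩
      rw [mem_closedBall_zero_iff, norm_mul, Real.norm_of_nonneg hε.le]
      exact (mul_le_mul_of_nonneg_left (norm_le_pi_norm q x₀) hε.le).trans hqn
    have h1 : g p ≤ g (w, ε * q x₀) := hp hmem
    have h2 : (fun x => T w x - w x - ε * q x₀) = ε • (γ⁻¹ • w) := by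
      rw [← hwq]
      have hw' : w = fun x => (γ • q) x + -(γ • q) x₀ := by
        ext x; simp [hwdef, sub_eq_add_neg]
      ext x
      have h3 := congrFun hres x
      have h4 : T w x = T (γ • q) x + -(γ • q) x₀ := by
        rw [hw']; exact congrFun (dpOperator_add_const _ _) x
      have h5 : w x = γ * q x - γ * q x₀ := rfl
      change T w x - w x - ε * q x₀ = ε * (q x - q x₀)
      rw [h4, h5]
      simp only [Pi.sub_apply, Pi.smul_apply, smul_eq_mul] at h3 ⊢
      linear_combination h3
    refine h1.trans ?_
    simp only [hg]
    rw [h2, norm_smul, norm_smul, norm_inv, Real.norm_of_nonneg hε.le, Real.norm_of_nonneg hγ0]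
    refine mul_le_mul_of_nonneg_left ?_ hε.le
    refine mul_le_mul ?_ hw (norm_nonneg _) zero_le_two
    rw [inv_le_comm₀ (by linarith) two_pos]
    linarith
  have hg0 : g p = 0 := by
    refine le_antisymm ?_ (norm_nonneg _)
    have hlim : Tendsto (fun ε : ℝ => ε * (2 * B)) (𝓝[>] 0) (𝓝 0) := by
      have := (tendsto_id.mul_const (2 * B) : Tendsto (fun ε : ℝ => id ε * (2 * B)) (𝓝 0) _)
      rw [zero_mul] at this
      exact this.mono_left nhdsWithin_le_nhds
    refine ge_of_tendsto hlim ?_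
    filter_upwards [Ioc_mem_nhdsGT (by norm_num : (0 : ℝ) < 1 / 2)] with ε hε
    exact hsmall ε hε.1 hε.2
  refine ⟨p.2 / α, p.1, (dpOperator_sub_self_eq_iff hα hα' p.1 (p.2 / α)).1 fun x => ?_⟩
  have := congrFun (norm_eq_zero.1 hg0) x
  simp only [Pi.zero_apply] at this
  rw [mul_div_cancel₀ _ hα.ne']
  exact sub_eq_zero.1 this

end Operator

end SMDP

/-! ### Flows y' = F(y) - y with F nonexpansive. -/

section NonexpansiveFlow

variable {E : Type*} [NormedAddCommGroup E] [NormedSpace ℝ E]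

lemma IsForwardSolution.shift {h : E → E} {y : ℝ → E} (hy : IsForwardSolution h y) {s : ℝ}
    (hs : 0 ≤ s) : IsForwardSolution h (fun t => y (t + s)) := by
  intro t ht
  have h1 := hy (t + s) (add_nonneg ht hs)
  have h2 : HasDerivWithinAt (fun t : ℝ => t + s) 1 (Set.Ici 0) t :=
    (hasDerivWithinAt_id t _).add_const s
  have h3 := h1.scomp t h2 fun u (hu : 0 ≤ u) => add_nonneg hu hs
  rw [one_smul] at h3
  exact h3

lemma isForwardSolution_const {h : E → E} {q : E} (hq : h q = 0) :
    IsForwardSolution h (fun _ => q) := by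
  intro t _
  simpa [hq] using hasDerivWithinAt_const t (Set.Ici (0 : ℝ)) q

lemma IsForwardSolution.continuousOn {h : E → E} {y : ℝ → E} (hy : IsForwardSolution h y) :
    ContinuousOn y (Set.Ici 0) := fun t ht => (hy t ht).continuousWithinAt

/-- The flow of `y' = F(y) - y` is nonexpansive if `F` is. -/
lemma IsForwardSolution.norm_sub_le {F : E → E} (hF : ∀ p q, ‖F p - F q‖ ≤ ‖p - q‖)
    {y₁ y₂ : ℝ → E} (h₁ : IsForwardSolution (fun q => F q - q) y₁)
    (h₂ : IsForwardSolution (fun q => F q - q) y₂) {t : ℝ} (ht : 0 ≤ t) :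
    ‖y₁ t - y₂ t‖ ≤ ‖y₁ 0 - y₂ 0‖ := by
  -- The factor e^t absorbs the term -y, so that W' involves only differences of F and Grönwall
  -- gives growth at most e^t.
  set W : ℝ → E := fun t => Real.exp t • (y₁ t - y₂ t) with hW
  have hd : ∀ u ∈ Set.Ici (0 : ℝ), HasDerivWithinAt W
      (Real.exp u • (F (y₁ u) - F (y₂ u))) (Set.Ici 0) u := by
    intro u hu
    have h3 : HasDerivWithinAt W (Real.exp u • ((F (y₁ u) - y₁ u) - (F (y₂ u) - y₂ u)) +
        Real.exp u • (y₁ u - y₂ u)) (Set.Ici 0) u :=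
      (Real.hasDerivAt_exp u).hasDerivWithinAt.smul ((h₁ u hu).sub (h₂ u hu))
    convert h3 using 1
    module
  have hc : ContinuousOn W (Set.Icc 0 t) := fun u hu =>
    (hd u hu.1).continuousWithinAt.mono fun v hv => hv.1
  have := norm_le_gronwallBound_of_norm_deriv_right_le (f := W)
    (f' := fun u => Real.exp u • (F (y₁ u) - F (y₂ u))) (δ := ‖W 0‖) (K := 1) (ε := 0) hc
    (fun u hu => (hd u hu.1).mono (Set.Ici_subset_Ici.2 hu.1)) le_rfl
    (fun u _ => by
      simp only [hW, norm_smul, one_mul, add_zero]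
      exact mul_le_mul_of_nonneg_left (hF _ _) (norm_nonneg _)) t ⟨ht, le_rfl⟩
  rw [gronwallBound_ε0] at this
  simp only [hW, norm_smul, Real.norm_of_nonneg (Real.exp_pos _).le, Real.exp_zero, one_mul,
    sub_zero, norm_one] at this
  rw [mul_comm] at this
  exact le_of_mul_le_mul_right this (Real.exp_pos t)

/-- A solution and its time shift by v do not separate; dividing by v and letting v → 0 compares the
speeds. -/
lemma IsForwardSolution.norm_field_le {F : E → E} (hF : ∀ p q, ‖F p - F q‖ ≤ ‖p - q‖)
    {y : ℝ → E} (hy : IsForwardSolution (fun q => F q - q) y) {s t : ℝ} (hs : 0 ≤ s)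
    (hst : s ≤ t) : ‖F (y t) - y t‖ ≤ ‖F (y s) - y s‖ := by
  have ht := hs.trans hst
  have hslope : ∀ u, 0 ≤ u → Tendsto (fun v => ‖slope (fun v => y (v + u)) 0 v‖) (𝓝[>] 0)
      (𝓝 ‖F (y u) - y u‖) := by
    intro u hu
    have h1 := hasDerivWithinAt_iff_tendsto_slope.1 (hy.shift hu 0 (Set.mem_Ici.2 le_rfl))
    rw [Set.Ici_sdiff_left] at h1
    simp only [zero_add] at h1
    exact h1.norm
  refine le_of_tendsto_of_tendsto (hslope t ht) (hslope s hs) ?_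
  filter_upwards [self_mem_nhdsWithin] with v (hv : 0 < v)
  simp only [slope, vsub_eq_sub, sub_zero, zero_add, norm_smul]
  refine mul_le_mul_of_nonneg_left ?_ (norm_nonneg _)
  have h2 := (hy.shift (add_nonneg hv.le hs)).norm_sub_le hF (hy.shift hs) (sub_nonneg.2 hst)
  simp only [zero_add] at h2
  have e1 : t - s + (v + s) = v + t := by ring
  have e2 : t - s + s = t := by ring
  rwa [e1, e2] at h2

end NonexpansiveFlow

/-- If `p' = u - p`, where `u` grows at rate at most `K` and `p` has slope at least `K - δ` at the
final time, then `p` has nearly that slope over the whole interval. -/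
lemma le_sub_of_relaxation {p u : ℝ → ℝ} {T K δ : ℝ} (hT : 0 ≤ T)
    (hp : ∀ t ∈ Set.Icc 0 T, HasDerivWithinAt p (u t - p t) (Set.Icc 0 T) t)
    (hu : ∀ t ∈ Set.Icc 0 T, u T - u t ≤ K * (T - t)) (hend : K - δ ≤ u T - p T) :
    K + K * T - Real.exp T * δ ≤ u T - p 0 := by
  -- The weighted gap between p and a line of slope K is nondecreasing: its derivative is e^t (u t -
  -- u T + K (T - t)) ≥ 0.
  set e : ℝ → ℝ := fun t => Real.exp t * (p t - (u T - K - K * (T - t))) with he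
  have hd : ∀ t ∈ Set.Icc 0 T, HasDerivWithinAt e
      (Real.exp t * (p t - (u T - K - K * (T - t))) + Real.exp t * (u t - p t - K))
      (Set.Icc 0 T) t := by
    intro t ht
    have h1 : HasDerivWithinAt (fun t => u T - K - K * (T - t)) K (Set.Icc 0 T) t := by
      have := (((hasDerivWithinAt_id t (Set.Icc 0 T)).const_sub T).const_mul K).const_sub (u T - K)
      simpa using this
    exact ((Real.hasDerivAt_exp t).hasDerivWithinAt).mul ((hp t ht).sub h1)
  have hmono : MonotoneOn e (Set.Icc 0 T) := by
    refine monotoneOn_of_hasDerivWithinAt_nonneg (convex_Icc 0 T)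
      (fun t ht => (hd t ht).continuousWithinAt)
      (fun t ht => (hd t (interior_subset ht)).mono interior_subset) fun t ht => ?_
    have h1 := hu t (interior_subset ht)
    rw [← mul_add]
    refine mul_nonneg (Real.exp_pos t).le ?_
    linarith
  have h0 := hmono ⟨le_rfl, hT⟩ ⟨hT, le_rfl⟩ hT
  simp only [he, Real.exp_zero, one_mul, sub_zero, sub_self, mul_zero] at h0
  have h1 : Real.exp T * (p T - (u T - K)) ≤ Real.exp T * δ :=
    mul_le_mul_of_nonneg_left (by linarith) (Real.exp_pos T).le
  linarith

section SupNorm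

variable {ι : Type*} [Fintype ι]

/-- A solution of `y' = F(y) - y` whose speed stays between `L` and `K` travels nearly as far as
`K T` by time `T`. -/
lemma IsForwardSolution.speed_mul_sub_le {F : (ι → ℝ) → ι → ℝ}
    (hF : ∀ p q, ‖F p - F q‖ ≤ ‖p - q‖) {z : ℝ → ι → ℝ}
    (hz : IsForwardSolution (fun q => F q - q) z) {R K L T : ℝ} (hL : 0 < L) (hT : 0 ≤ T)
    (hzR : ∀ t, 0 ≤ t → ‖z t‖ ≤ R) (hzK : ∀ t, 0 ≤ t → ‖F (z t) - z t‖ ≤ K)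
    (hzL : L ≤ ‖F (z T) - z T‖) : K * T - Real.exp T * (K - L) ≤ 2 * R := by
  have hLip : ∀ t ∈ Set.Icc 0 T, ‖F (z T) - F (z t)‖ ≤ K * (T - t) := by
    intro t ht
    refine (hF _ _).trans ?_
    have := Convex.norm_image_sub_le_of_norm_hasDerivWithin_le (f := z)
      (f' := fun t => F (z t) - z t) (s := Set.Ici 0) (C := K) (fun t ht => hz t ht)
      (fun t ht => hzK t ht) (convex_Ici 0) (x := t) (y := T) ht.1 hT
    rwa [Real.norm_of_nonneg (sub_nonneg.2 ht.2)] at this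
  -- The sup norm is attained in a coordinate, so the scalar relaxation estimate applies to it, with
  -- the sign σ making the motion upward.
  obtain ⟨i, hi⟩ : ∃ i, L ≤ |F (z T) i - z T i| := by
    by_contra! hc
    exact absurd hzL (not_le.2 ((pi_norm_lt_iff hL).2 hc))
  obtain ⟨σ, hσ, hσi⟩ : ∃ σ : ℝ, |σ| = 1 ∧ σ * (F (z T) i - z T i) = |F (z T) i - z T i| := by
    rcases abs_choice (F (z T) i - z T i) with h | h
    · exact ⟨1, abs_one, by rw [h, one_mul]⟩
    · exact ⟨-1, by rw [abs_neg, abs_one], by rw [h, neg_one_mul]⟩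
  have hσle : ∀ v : ι → ℝ, σ * v i ≤ ‖v‖ := fun v => by
    refine (le_abs_self _).trans ?_
    rw [abs_mul, hσ, one_mul]
    exact norm_le_pi_norm v i
  have hd : ∀ t ∈ Set.Icc 0 T, HasDerivWithinAt (fun t => σ * z t i) (σ * F (z t) i - σ * z t i)
      (Set.Icc 0 T) t := by
    intro t ht
    have h1 : HasDerivWithinAt (fun t => z t i) (F (z t) i - z t i) (Set.Ici 0) t :=
      hasDerivWithinAt_pi.1 (hz t ht.1) i
    rw [← mul_sub]
    exact (h1.const_mul σ).mono fun v hv => hv.1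
  have hu : ∀ t ∈ Set.Icc 0 T, σ * F (z T) i - σ * F (z t) i ≤ K * (T - t) := by
    intro t ht
    rw [← mul_sub]
    exact (hσle (F (z T) - F (z t))).trans (hLip t ht)
  have key := le_sub_of_relaxation (p := fun t => σ * z t i) (u := fun t => σ * F (z t) i)
    (K := K) (δ := K - L) hT hd hu (by
      rw [sub_sub_cancel, ← mul_sub, hσi]
      exact hi)
  have h1 : σ * (F (z T) i - z T i) ≤ K := (hσle (F (z T) - z T)).trans (hzK T hT)
  have h2 := (hσle (z T)).trans (hzR T hT)
  have h3 : σ * -z 0 i ≤ R :=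
    (hσle (-z 0)).trans ((norm_neg (z 0)).le.trans (hzR 0 le_rfl))
  beta_reduce at key
  linarith

/-- The velocity of a bounded solution of `y' = F(y) - y` becomes arbitrarily small. -/
lemma IsForwardSolution.exists_norm_field_lt {F : (ι → ℝ) → ι → ℝ}
    (hF : ∀ p q, ‖F p - F q‖ ≤ ‖p - q‖) {y : ℝ → ι → ℝ}
    (hy : IsForwardSolution (fun q => F q - q) y) {R : ℝ} (hR : ∀ t, 0 ≤ t → ‖y t‖ ≤ R) {ε : ℝ}
    (hε : 0 < ε) : ∃ t, 0 ≤ t ∧ ‖F (y t) - y t‖ < ε := by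
  by_contra! hcon
  obtain ⟨L, hL⟩ : ∃ L, IsGLB ((fun t => ‖F (y t) - y t‖) '' Set.Ici 0) L :=
    Real.exists_isGLB ⟨_, 0, Set.mem_Ici.2 le_rfl, rfl⟩
      ⟨0, by rintro _ ⟨t, -, rfl⟩; exact norm_nonneg _⟩
  have hLpos : 0 < L := hε.trans_le (hL.2 (by rintro _ ⟨t, ht, rfl⟩; exact hcon t ht))
  have hR0 : 0 ≤ R := (norm_nonneg _).trans (hR 0 le_rfl)
  -- T is long enough that moving at speed L exceeds the diameter bound 2R by 2. Starting at a t₀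
  -- where the speed is within e^{-T} of its infimum L makes the loss e^T (K - L) equal to 1, which
  -- contradicts the bound 2R.
  obtain ⟨T, hT0, hLT⟩ : ∃ T, 0 ≤ T ∧ L * T = 2 * R + 2 :=
    ⟨(2 * R + 2) / L, by positivity, by field_simp⟩
  obtain ⟨_, ⟨t₀, ht₀, rfl⟩, -, hlt⟩ := hL.exists_between
    (lt_add_of_pos_right L (Real.exp_pos (-T)))
  have hb := (hy.shift ht₀).speed_mul_sub_le hF hLpos hT0 (K := L + Real.exp (-T))
    (fun t ht => hR _ (add_nonneg ht ht₀))
    (fun t ht => (hy.norm_field_le hF ht₀ (le_add_of_nonneg_left ht)).trans hlt.le)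
    (hL.1 ⟨T + t₀, add_nonneg hT0 ht₀, rfl⟩)
  have hexp : Real.exp T * Real.exp (-T) = 1 := by rw [← Real.exp_add, add_neg_cancel, Real.exp_zero]
  rw [add_sub_cancel_left, hexp] at hb
  have := mul_nonneg (Real.exp_pos (-T)).le hT0
  linarith

/-- If `F` is nonexpansive for the sup norm and has a fixed point, every solution of `y' = F(y) - y`
converges to a fixed point. -/
theorem IsForwardSolution.exists_tendsto_fixedPoint {F : (ι → ℝ) → ι → ℝ}
    (hF : ∀ p q, ‖F p - F q‖ ≤ ‖p - q‖) {q : ι → ℝ} (hq : F q = q) {y : ℝ → ι → ℝ}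
    (hy : IsForwardSolution (fun q => F q - q) y) :
    ∃ p, F p = p ∧ Tendsto y atTop (𝓝 p) := by
  have hfix : ∀ p, F p = p → ∀ s t, 0 ≤ s → s ≤ t → ‖y t - p‖ ≤ ‖y s - p‖ := by
    intro p hp s t hs hst
    have := (hy.shift hs).norm_sub_le hF (isForwardSolution_const (sub_eq_zero.2 hp))
      (sub_nonneg.2 hst)
    simpa using this
  have hR : ∀ t, 0 ≤ t → ‖y t‖ ≤ ‖y 0 - q‖ + ‖q‖ := fun t ht =>
    (norm_le_norm_sub_add (y t) q).trans (add_le_add_left (hfix q hq 0 t le_rfl ht) _)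
  have hFc : Continuous F := (LipschitzWith.of_dist_le_mul (K := 1) fun p q => by
    rw [dist_eq_norm, dist_eq_norm, NNReal.coe_one, one_mul]; exact hF p q).continuous
  have hres : Tendsto (fun n : ℕ => F (y n) - y n) atTop (𝓝 0) := by
    rw [tendsto_zero_iff_norm_tendsto_zero, Metric.tendsto_atTop]
    intro ε hε
    obtain ⟨t, ht, hlt⟩ := hy.exists_norm_field_lt hF hR hε
    refine ⟨⌈t⌉₊, fun n hn => ?_⟩
    rw [Real.dist_eq, sub_zero, abs_of_nonneg (norm_nonneg _)]
    exact (hy.norm_field_le hF ht ((Nat.le_ceil t).trans (Nat.cast_le.2 hn))).trans_lt hlt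
  obtain ⟨p, -, φ, hφ, hlim⟩ := (isCompact_closedBall (0 : ι → ℝ) (‖y 0 - q‖ + ‖q‖)).tendsto_subseq
    (x := fun n : ℕ => y n) fun n => by simpa using hR n n.cast_nonneg
  have hp : F p = p := by
    have h1 : Tendsto (fun n => F (y (φ n)) - y (φ n)) atTop (𝓝 (F p - p)) :=
      ((hFc.tendsto p).comp hlim).sub hlim
    exact sub_eq_zero.1 (tendsto_nhds_unique h1 (hres.comp hφ.tendsto_atTop))
  -- The distance to the fixed point p is nonincreasing, so convergence along a subsequence is
  -- convergence.
  refine ⟨p, hp, Metric.tendsto_atTop.2 fun ε hε => ?_⟩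
  obtain ⟨n, hn⟩ := (Metric.tendsto_atTop.1 hlim ε hε)
  refine ⟨φ n, fun t ht => ?_⟩
  have h1 := hn n le_rfl
  rw [dist_eq_norm] at h1 ⊢
  exact (hfix p hp _ t (Nat.cast_nonneg _) ht).trans_lt h1

end SupNorm

/-! ### Barrier arguments for scalar equations. -/

section ScalarBarrier

variable {z g : ℝ → ℝ}

lemma le_of_deriv_neg_at_barrier (hz : ∀ t, 0 ≤ t → HasDerivWithinAt z (g t) (Set.Ici 0) t)
    {t₀ c : ℝ} (ht₀ : 0 ≤ t₀) (h0 : z t₀ ≤ c) (hg : ∀ t, t₀ ≤ t → z t = c → g t < 0) {t : ℝ}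
    (ht : t₀ ≤ t) : z t ≤ c :=
  image_le_of_deriv_right_lt_deriv_boundary' (f := z) (f' := g) (B := fun _ => c)
    (B' := fun _ => 0)
    (fun u hu => (hz u (ht₀.trans hu.1)).continuousWithinAt.mono fun _ hv => ht₀.trans hv.1)
    (fun u hu => (hz u (ht₀.trans hu.1)).mono (Set.Ici_subset_Ici.2 (ht₀.trans hu.1))) h0
    continuousOn_const (fun u _ => hasDerivWithinAt_const u _ c)
    (fun u hu h => hg u hu.1 h) ⟨ht, le_rfl⟩

/-- Above c the function falls at rate at least η, so it reaches c in finite time; there the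
derivative is negative, so it cannot cross back. -/
lemma eventually_le_of_deriv_le_neg (hz : ∀ t, 0 ≤ t → HasDerivWithinAt z (g t) (Set.Ici 0) t)
    {t₀ c η : ℝ} (ht₀ : 0 ≤ t₀) (hη : 0 < η) (hg : ∀ t, t₀ ≤ t → c ≤ z t → g t ≤ -η) :
    ∀ᶠ t in atTop, z t ≤ c := by
  obtain ⟨t₁, ht₁, hle⟩ : ∃ t₁, t₀ ≤ t₁ ∧ z t₁ ≤ c := by
    by_contra! hc
    have hlin : ∀ t, t₀ ≤ t → z t ≤ z t₀ - η * (t - t₀) := by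
      intro t ht
      refine image_le_of_deriv_right_le_deriv_boundary (f := z) (f' := g)
        (B := fun t => z t₀ - η * (t - t₀)) (B' := fun _ => -η)
        (fun u hu => (hz u (ht₀.trans hu.1)).continuousWithinAt.mono fun _ hv => ht₀.trans hv.1)
        (fun u hu => (hz u (ht₀.trans hu.1)).mono (Set.Ici_subset_Ici.2 (ht₀.trans hu.1)))
        (by simp) (by fun_prop) (fun u _ => ?_)
        (fun u hu => hg u hu.1 (hc u hu.1).le) ⟨ht, le_rfl⟩
      have := (((hasDerivWithinAt_id u (Set.Ici u)).sub_const t₀).const_mul η).const_sub (z t₀)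
      simpa using this
    have hd : 0 ≤ (z t₀ - c) / η := div_nonneg (sub_nonneg.2 (hc t₀ le_rfl).le) hη.le
    have h1 := hlin (t₀ + (z t₀ - c) / η) (by linarith)
    have h2 := hc (t₀ + (z t₀ - c) / η) (by linarith)
    rw [add_sub_cancel_left, mul_div_cancel₀ _ hη.ne'] at h1
    linarith
  filter_upwards [eventually_ge_atTop t₁] with t ht
  exact le_of_deriv_neg_at_barrier hz (ht₀.trans ht₁) hle
    (fun u hu h => (hg u (ht₁.trans hu) h.ge).trans_lt (neg_neg_of_pos hη)) ht

/-- The scalar component of a solution stays small if the vector component stays close to a point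
where `f` has the value `r`. -/
lemma abs_scalar_le {ι : Type*} {f : (ι → ℝ) → ℝ} {α r ε η : ℝ} (hα : 0 < α) (hε : 0 ≤ ε) {q : ι → ℝ}
    (hup : r + η ≤ f fun i => q i + ε) (hlow : (f fun i => q i + -ε) ≤ r - η) {y : ℝ → ι → ℝ}
    (hy : ∀ t c, 0 ≤ t → |(f fun i => y t i + c) - f fun i => q i + c| < η)
    (hz : ∀ t, 0 ≤ t →
      HasDerivWithinAt z (α * (r - f fun i => y t i + z t)) (Set.Ici 0) t) (hz0 : z 0 = 0)
    {t : ℝ} (ht : 0 ≤ t) : |z t| ≤ ε := by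
  rw [abs_le, neg_le]
  constructor
  · refine le_of_deriv_neg_at_barrier (z := fun t => -z t) (fun t ht => (hz t ht).neg) le_rfl
      (by simpa [hz0] using hε) (fun u hu h => ?_) ht
    have hzu : z u = -ε := by linarith
    -- At the levels ±ε the gap η outweighs the error of replacing y by q, so the drift of z points
    -- strictly inward.
    have h1 := (abs_lt.1 (hy u (-ε) hu)).2
    rw [hzu]
    exact neg_neg_of_pos (mul_pos hα (by linarith))
  · refine le_of_deriv_neg_at_barrier hz le_rfl (by rw [hz0]; exact hε) (fun u hu h => ?_) ht
    have h1 := (abs_lt.1 (hy u ε hu)).1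
    rw [h]
    exact mul_neg_of_pos_of_neg hα (by linarith)

end ScalarBarrier

/-! ### Splitting a solution into a nonexpansive part and a scalar part. -/

section Decomposition

variable {ι : Type*} [Fintype ι]

/-- If `T` commutes with scalar translations, a solution of `x' = T(x) - x - α f(x)` is the sum
of a solution of `y' = T(y) - y - α r` and a scalar function. -/
lemma IsForwardSolution.exists_decomposition {T : (ι → ℝ) → ι → ℝ}
    (hT : ∀ q c, T (fun i => q i + c) = fun i => T q i + c) {f : (ι → ℝ) → ℝ} (hf : Continuous f)
    (α r : ℝ) {x : ℝ → ι → ℝ}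
    (hx : IsForwardSolution (fun q => fun i => T q i - q i - α * f q) x) :
    ∃ (y : ℝ → ι → ℝ) (z : ℝ → ℝ),
      IsForwardSolution (fun q => (fun i => T q i - α * r) - q) y ∧
      (∀ t, 0 ≤ t → HasDerivWithinAt z (α * (r - f (x t))) (Set.Ici 0) t) ∧ z 0 = 0 ∧
      ∀ t, x t = fun i => y t i + z t := by
  -- Nothing is known about x at negative times; freezing it there gives a continuous integrand on
  -- ℝ, so its primitive is differentiable at 0 as well.
  have hxc : Continuous fun s : ℝ => x (max s 0) :=
    hx.continuousOn.comp_continuous (by fun_prop) fun s => le_max_right s 0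
  set g : ℝ → ℝ := fun s => α * (r - f (x (max s 0))) with hg
  have hgc : Continuous g := continuous_const.mul (continuous_const.sub (hf.comp hxc))
  set z : ℝ → ℝ := fun t => ∫ s in (0 : ℝ)..t, g s with hz
  have hzd : ∀ t, 0 ≤ t → HasDerivWithinAt z (α * (r - f (x t))) (Set.Ici 0) t := by
    intro t ht
    have := (hgc.integral_hasStrictDerivAt 0 t).hasDerivAt.hasDerivWithinAt (s := Set.Ici 0)
    simpa only [hg, max_eq_left ht] using this
  refine ⟨fun t i => x t i - z t, z, fun t ht => ?_, hzd, by simp [hz], fun t => by ext i; simp⟩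
  rw [hasDerivWithinAt_pi]
  intro i
  have h1 : HasDerivWithinAt (fun t => x t i) (T (x t) i - x t i - α * f (x t)) (Set.Ici 0) t :=
    hasDerivWithinAt_pi.1 (hx t ht) i
  have h2 : HasDerivWithinAt (fun t => x t i - z t) _ (Set.Ici 0) t := h1.sub (hzd t ht)
  have h3 : T (fun i => x t i - z t) i = T (x t) i - z t := by
    have := congrFun (hT (x t) (-z t)) i
    simpa only [← sub_eq_add_neg] using this
  refine h2.congr_deriv (Eq.symm ?_)
  change T (fun i => x t i - z t) i - α * r - (x t i - z t) = _
  rw [h3]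
  ring

end Decomposition

/-! ### Scalar translations of f and the scalar component. -/

section RateFunction

variable {ι : Type*} [Fintype ι] {f : (ι → ℝ) → ℝ}

lemma RateFunctionConditions.continuous (hf : RateFunctionConditions f) : Continuous f :=
  hf.lipschitz.choose_spec.continuous

lemma RateFunctionConditions.exists_abs_sub_le (hf : RateFunctionConditions f) :
    ∃ L : ℝ, 0 ≤ L ∧ ∀ p q, |f p - f q| ≤ L * ‖p - q‖ := by
  obtain ⟨L, hL⟩ := hf.lipschitz
  refine ⟨L, L.coe_nonneg, fun p q => ?_⟩
  have := hL.dist_le_mul p q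
  rwa [Real.dist_eq, dist_eq_norm] at this

/-- The scalar component of a solution converges as soon as the vector component does. -/
lemma RateFunctionConditions.tendsto_scalar (hf : RateFunctionConditions f) {α r : ℝ} (hα : 0 < α)
    {y : ℝ → ι → ℝ} {p : ι → ℝ} (hy : Tendsto y atTop (𝓝 p)) {z : ℝ → ℝ}
    (hz : ∀ t, 0 ≤ t →
      HasDerivWithinAt z (α * (r - f fun i => y t i + z t)) (Set.Ici 0) t) :
    ∃ c, (f fun i => p i + c) = r ∧ Tendsto z atTop (𝓝 c) := by
  obtain ⟨L, hL0, hL⟩ := hf.exists_abs_sub_le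
  obtain ⟨c, hc⟩ := (hf.sistr p).2 r
  have hmono := (hf.sistr p).1
  refine ⟨c, hc, ?_⟩
  -- The error is uniform in the translation c, so no bound on z is required beforehand.
  have hdiff : ∀ t c, |(f fun i => y t i + c) - f fun i => p i + c| ≤ L * ‖y t - p‖ := by
    intro t c
    refine (hL _ _).trans (le_of_eq ?_)
    congr 2
    ext i
    simp
  have hlim : Tendsto (fun t => L * ‖y t - p‖) atTop (𝓝 0) := by
    have := (tendsto_iff_norm_sub_tendsto_zero.1 hy).const_mul L
    rwa [mul_zero] at this
  have hsmall : ∀ η, 0 < η → ∃ t₀, 0 ≤ t₀ ∧ ∀ t, t₀ ≤ t → L * ‖y t - p‖ < η := by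
    intro η hη
    obtain ⟨t₀, h⟩ := eventually_atTop.1 (hlim.eventually_lt_const hη)
    exact ⟨max t₀ 0, le_max_right _ _, fun t ht => h t ((le_max_left _ _).trans ht)⟩
  have hc' : (f fun i => p i + c) = r := hc
  have hup : ∀ ε, 0 < ε → ∀ᶠ t in atTop, z t ≤ c + ε := by
    intro ε hε
    have hη : (f fun i => p i + c) < f fun i => p i + (c + ε) := hmono (by linarith)
    rw [hc'] at hη
    -- Half of the gap absorbs the error from replacing y t by p; the other half is the rate of
    -- descent.
    obtain ⟨t₀, ht₀, h⟩ := hsmall (((f fun i => p i + (c + ε)) - r) / 2) (by linarith)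
    refine eventually_le_of_deriv_le_neg hz ht₀
      (η := α * (((f fun i => p i + (c + ε)) - r) / 2)) (mul_pos hα (by linarith))
      fun t ht hzt => ?_
    have h1 := (abs_le.1 (hdiff t (z t))).1
    have h2 : (f fun i => p i + (c + ε)) ≤ f fun i => p i + z t := hmono.monotone hzt
    have h3 := h t ht
    rw [← mul_neg]
    exact mul_le_mul_of_nonneg_left (by linarith) hα.le
  have hlow : ∀ ε, 0 < ε → ∀ᶠ t in atTop, -z t ≤ -c + ε := by
    intro ε hε
    have hη : (f fun i => p i + (c - ε)) < f fun i => p i + c := hmono (by linarith)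
    rw [hc'] at hη
    obtain ⟨t₀, ht₀, h⟩ := hsmall ((r - f fun i => p i + (c - ε)) / 2) (by linarith)
    refine eventually_le_of_deriv_le_neg (z := fun t => -z t) (fun t ht => (hz t ht).neg) ht₀
      (η := α * ((r - f fun i => p i + (c - ε)) / 2)) (mul_pos hα (by linarith))
      fun t ht hzt => ?_
    have h1 := (abs_le.1 (hdiff t (z t))).2
    have h2 : (f fun i => p i + z t) ≤ f fun i => p i + (c - ε) :=
      hmono.monotone (by linarith)
    have h3 := h t ht
    exact neg_le_neg (mul_le_mul_of_nonneg_left (by linarith) hα.le)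
  rw [Metric.tendsto_nhds]
  intro ε hε
  filter_upwards [hup (ε / 2) (by linarith), hlow (ε / 2) (by linarith)] with t h1 h2
  rw [Real.dist_eq, abs_lt]
  constructor <;> linarith

/-- The values of `f` leave the level `r` uniformly when points of a compact part of the level set
are translated. -/
lemma RateFunctionConditions.exists_uniform_gap (hf : RateFunctionConditions f) {K : Set (ι → ℝ)}
    (hK : IsCompact K) (hKn : K.Nonempty) {r : ℝ} (hr : ∀ q ∈ K, f q = r) {ε : ℝ} (hε : 0 < ε) :
    ∃ η, 0 < η ∧ ∀ q ∈ K, r + η ≤ (f fun i => q i + ε) ∧ (f fun i => q i + -ε) ≤ r - η := by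
  have hcont : ∀ c : ℝ, Continuous fun q : ι → ℝ => f fun i => q i + c := fun c =>
    hf.continuous.comp (by fun_prop)
  obtain ⟨q₁, h₁, hm₁⟩ := hK.exists_isMinOn hKn (hcont ε).continuousOn
  obtain ⟨q₂, h₂, hm₂⟩ := hK.exists_isMaxOn hKn (hcont (-ε)).continuousOn
  have e₁ : (f fun i => q₁ i + 0) < f fun i => q₁ i + ε := (hf.sistr q₁).1 hε
  have e₂ : (f fun i => q₂ i + -ε) < f fun i => q₂ i + 0 := (hf.sistr q₂).1 (neg_neg_of_pos hε)
  simp only [add_zero, hr q₁ h₁, hr q₂ h₂] at e₁ e₂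
  refine ⟨min ((f fun i => q₁ i + ε) - r) (r - f fun i => q₂ i + -ε),
    lt_min (by linarith) (by linarith), fun q hq => ⟨?_, ?_⟩⟩
  · have h1 : (f fun i => q₁ i + ε) ≤ f fun i => q i + ε := hm₁ hq
    have h2 := min_le_left ((f fun i => q₁ i + ε) - r) (r - f fun i => q₂ i + -ε)
    linarith
  · have h1 : (f fun i => q i + -ε) ≤ f fun i => q₂ i + -ε := hm₂ hq
    have h2 := min_le_right ((f fun i => q₁ i + ε) - r) (r - f fun i => q₂ i + -ε)
    linarith

end RateFunction

namespace SMDP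

/-! ### Equilibria, compactness, convergence and stability. -/

section MainResults

variable {S A : Type*} [Fintype S] [Fintype A] [Nonempty S] [Nonempty A]
    [MeasurableSpace S] [MeasurableSpace A] [MeasurableSingletonClass S]
    [MeasurableSingletonClass A] {M : SMDP S A} {f : (S × A → ℝ) → ℝ} {α : ℝ}

/-- Verification forces the constant in the equation to be the optimal rate, which is f(q) by
membership. -/
lemma ModelConditions.mem_aoeSolutionsAt_iff (hM : M.ModelConditions) {q : S × A → ℝ} :
    q ∈ M.aoeSolutionsAt f ↔ M.SolvesAOE (f q) q := by
  refine ⟨?_, fun h => ⟨⟨f q, h⟩, hM.optReward_eq h⟩⟩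
  rintro ⟨⟨r, hr⟩, h⟩
  have h1 := (hM.optReward_eq hr (Classical.arbitrary S)).symm.trans (h _)
  rwa [← EReal.coe_eq_coe_iff.1 h1]

lemma ModelConditions.solvesAOE_unique (hM : M.ModelConditions) {r r' : ℝ} {q q' : S × A → ℝ}
    (hq : M.SolvesAOE r q) (hq' : M.SolvesAOE r' q') : r = r' :=
  EReal.coe_eq_coe_iff.1 ((hM.optReward_eq hq (Classical.arbitrary S)).symm.trans
    (hM.optReward_eq hq' _))

lemma aoeSolutionsAt_nonempty (hM : M.ModelConditions) (hf : RateFunctionConditions f) {r : ℝ}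
    {q : S × A → ℝ} (hq : M.SolvesAOE r q) : (M.aoeSolutionsAt f).Nonempty := by
  obtain ⟨c, hc⟩ := (hf.sistr q).2 r
  refine ⟨fun x => q x + c, hM.mem_aoeSolutionsAt_iff.2 ?_⟩
  have hc' : (f fun x => q x + c) = r := hc
  rw [hc']
  exact solvesAOE_add_const hq c

/-- All points of the set have the same residual, so they are bounded up to an additive constant;
the level condition f(q) = r bounds that constant. -/
lemma isCompact_aoeSolutionsAt (hM : M.ModelConditions) (hW : M.WeaklyCommunicating)
    (hf : RateFunctionConditions f) (hα : 0 < α) (hα' : ∀ s a, α ≤ M.holding s a) :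
    IsCompact (M.aoeSolutionsAt f) := by
  have hset : M.aoeSolutionsAt f = {q | M.dpOperator α q - q = fun _ => α * f q} := by
    ext q
    rw [hM.mem_aoeSolutionsAt_iff, ← dpOperator_sub_self_eq_iff hα hα', Set.mem_ofPred_eq,
      funext_iff]
    rfl
  have hclosed : IsClosed (M.aoeSolutionsAt f) := by
    rw [hset]
    have hfc := hf.continuous
    exact isClosed_eq ((continuous_dpOperator hα hα').sub continuous_id) (by fun_prop)
  obtain ⟨r, q₀, hq₀⟩ := hW.exists_solvesAOE hα hα'
  obtain ⟨x₀⟩ : Nonempty (S × A) := inferInstance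
  obtain ⟨B, hB0, hB⟩ := hW.exists_norm_sub_le hα hα' x₀ |α * r|
  obtain ⟨L, hL0, hL⟩ := hf.exists_abs_sub_le
  -- The constant function with value q x₀ lies within B of q, so f takes there a value within L B
  -- of r; strict monotonicity puts q x₀ in [c₁, c₂].
  obtain ⟨c₁, hc₁⟩ := (hf.sistr 0).2 (r - L * B)
  obtain ⟨c₂, hc₂⟩ := (hf.sistr 0).2 (r + L * B)
  refine Metric.isCompact_of_isClosed_isBounded hclosed
    ((Metric.isBounded_closedBall (x := (0 : S × A → ℝ)) (r := B + max |c₁| |c₂|)).subset ?_)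
  intro q hq
  have hq1 := hM.mem_aoeSolutionsAt_iff.1 hq
  have hfq : f q = r := hM.solvesAOE_unique hq1 hq₀
  have hres : M.dpOperator α q - q = fun _ => α * r := by
    rw [hset, Set.mem_ofPred_eq, hfq] at hq
    exact hq
  have hw := hB q (by rw [hres]; exact pi_norm_const_le _)
  have hmono := (hf.sistr 0).1
  have hd : |f q - f fun i => (0 : S × A → ℝ) i + q x₀| ≤ L * B := by
    refine (hL _ _).trans (mul_le_mul_of_nonneg_left (le_trans (le_of_eq ?_) hw) hL0)
    congr 1
    ext x
    simp
  rw [hfq, abs_le] at hd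
  have h1 : c₁ ≤ q x₀ := by
    refine hmono.le_iff_le.1 ?_
    linarith [hd.2]
  have h2 : q x₀ ≤ c₂ := by
    refine hmono.le_iff_le.1 ?_
    linarith [hd.1]
  have h3 : |q x₀| ≤ max |c₁| |c₂| := abs_le_max_abs_abs h1 h2
  rw [mem_closedBall_zero_iff, pi_norm_le_iff_of_nonneg (by positivity)]
  intro x
  have h4 : |q x - q x₀| ≤ B := (norm_le_pi_norm (fun x => q x - q x₀) x).trans hw
  calc ‖q x‖ = |(q x - q x₀) + q x₀| := by rw [sub_add_cancel, Real.norm_eq_abs]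
    _ ≤ _ := (abs_add_le _ _).trans (add_le_add h4 h3)

/-- The vector part converges to some solution p of the equation, and the scalar part to the
constant c with f(p + c) = r; translating p by c keeps it a solution. -/
lemma exists_tendsto_aoeSolutionsAt (hM : M.ModelConditions) (hf : RateFunctionConditions f)
    (hα : 0 < α) (hα' : ∀ s a, α ≤ M.holding s a) {r : ℝ} {q₀ : S × A → ℝ}
    (hq₀ : M.SolvesAOE r q₀) {x : ℝ → S × A → ℝ} (hx : IsForwardSolution (M.rviField α f) x) :
    ∃ q ∈ M.aoeSolutionsAt f, Tendsto x atTop (𝓝 q) := by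
  obtain ⟨y, z, hy, hz, -, hxyz⟩ := IsForwardSolution.exists_decomposition
    (T := M.dpOperator α) (fun q c => dpOperator_add_const q c) hf.continuous α r hx
  have hfix : ∀ p : S × A → ℝ, (fun x => M.dpOperator α p x - α * r) = p ↔ M.SolvesAOE r p := by
    intro p
    rw [← dpOperator_sub_self_eq_iff hα hα', funext_iff]
    exact forall_congr' fun x => by constructor <;> intro h <;> linarith
  obtain ⟨p, hp, hyp⟩ := hy.exists_tendsto_fixedPoint
    (norm_sub_const_dpOperator_le hα hα' (α * r)) ((hfix q₀).2 hq₀)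
  obtain ⟨c, hc, hzc⟩ := hf.tendsto_scalar hα hyp (r := r) (z := z) fun t ht => by
    have := hz t ht
    rwa [hxyz t] at this
  refine ⟨fun x => p x + c, hM.mem_aoeSolutionsAt_iff.2 ?_, ?_⟩
  · rw [hc]
    exact solvesAOE_add_const ((hfix p).1 hp) c
  · rw [funext hxyz, tendsto_pi_nhds]
    exact fun i => (tendsto_pi_nhds.1 hyp i).add hzc

lemma exists_stability_radius (hM : M.ModelConditions) (hW : M.WeaklyCommunicating)
    (hf : RateFunctionConditions f) (hα : 0 < α) (hα' : ∀ s a, α ≤ M.holding s a) {ε : ℝ}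
    (hε : 0 < ε) :
    ∃ δ > 0, ∀ x : ℝ → S × A → ℝ, IsForwardSolution (M.rviField α f) x →
      Metric.infDist (x 0) (M.aoeSolutionsAt f) < δ →
        ∀ t ≥ 0, Metric.infDist (x t) (M.aoeSolutionsAt f) < ε := by
  obtain ⟨r, q₀, hq₀⟩ := hW.exists_solvesAOE hα hα'
  have hne := aoeSolutionsAt_nonempty hM hf hq₀
  have hlevel : ∀ q ∈ M.aoeSolutionsAt f, f q = r := fun q hq =>
    hM.solvesAOE_unique (hM.mem_aoeSolutionsAt_iff.1 hq) hq₀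
  obtain ⟨η, hη, hgap⟩ := hf.exists_uniform_gap (isCompact_aoeSolutionsAt hM hW hf hα hα') hne
    hlevel (half_pos hε)
  obtain ⟨L, hL0, hL⟩ := hf.exists_abs_sub_le
  -- The first bound keeps y within ε/2 of q. The second keeps the Lipschitz error below η, so that
  -- z stays within ε/2; L + 1 avoids dividing by zero.
  refine ⟨min (ε / 2) (η / (L + 1)), lt_min (half_pos hε) (by positivity), fun x hx hx0 t ht => ?_⟩
  obtain ⟨q, hq, hxq⟩ := (Metric.infDist_lt_iff hne).1 hx0
  rw [dist_eq_norm, lt_min_iff] at hxq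
  have hxη := (lt_div_iff₀ (by positivity)).1 hxq.2
  obtain ⟨y, z, hy, hz, hz0, hxyz⟩ := IsForwardSolution.exists_decomposition
    (T := M.dpOperator α) (fun q c => dpOperator_add_const q c) hf.continuous α r hx
  have hqr : M.SolvesAOE r q := hlevel q hq ▸ hM.mem_aoeSolutionsAt_iff.1 hq
  have hqfix : (fun x => M.dpOperator α q x - α * r) - q = 0 := by
    ext x
    have := (dpOperator_sub_self_eq_iff hα hα' q r).2 hqr x
    simp only [Pi.sub_apply, Pi.zero_apply]
    linarith
  have hy0 : y 0 = x 0 := by rw [hxyz 0]; simp [hz0]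
  have hyq : ∀ t, 0 ≤ t → ‖y t - q‖ ≤ ‖x 0 - q‖ := fun t ht => by
    rw [← hy0]
    exact hy.norm_sub_le (norm_sub_const_dpOperator_le hα hα' (α * r))
      (isForwardSolution_const hqfix) ht
  have hzt : |z t| ≤ ε / 2 := by
    refine abs_scalar_le hα (half_pos hε).le (hgap q hq).1 (hgap q hq).2 (y := y)
      (fun u c hu => ?_) (fun u hu => ?_) hz0 ht
    · refine (hL _ _).trans_lt ?_
      have h1 : (fun i => y u i + c) - (fun i => q i + c) = y u - q := by ext i; simp
      rw [h1]
      have h2 := mul_le_mul_of_nonneg_left (hyq u hu) hL0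
      nlinarith [norm_nonneg (x 0 - q)]
    · have := hz u hu
      rwa [hxyz u] at this
  refine (Metric.infDist_le_dist_of_mem hq).trans_lt ?_
  have h1 : x t - q = (y t - q) + fun _ => z t := by
    rw [hxyz t]; ext i; simp only [Pi.sub_apply, Pi.add_apply]; ring
  rw [dist_eq_norm, h1]
  have h2 : ‖(fun _ => z t : S × A → ℝ)‖ ≤ |z t| := pi_norm_const_le _
  linarith [norm_add_le (y t - q) (fun _ => z t), hyq t ht, hxq.1]

end MainResults

end SMDP

end

theorem mainTheorem8 {S A : Type*} [Fintype S] [Fintype A] [Nonempty S] [Nonempty A]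
    [MeasurableSpace S] [MeasurableSpace A] [MeasurableSingletonClass S]
    [MeasurableSingletonClass A] (M : SMDP S A) (hM : M.ModelConditions)
    (hW : M.WeaklyCommunicating) (f : (S × A → ℝ) → ℝ) (hf : RateFunctionConditions f)
    (α : ℝ) (hα : 0 < α) (hα' : ∀ s a, α ≤ M.holding s a) :
    {q | M.rviField α f q = 0} = M.aoeSolutionsAt f ∧
      IsGloballyAsympStable (M.rviField α f) (M.aoeSolutionsAt f) ∧
      ∀ x : ℝ → (S × A → ℝ), IsForwardSolution (M.rviField α f) x →
        ∃ q ∈ M.aoeSolutionsAt f, Tendsto x atTop (𝓝 q) := by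
  obtain ⟨r, q₀, hq₀⟩ := hW.exists_solvesAOE hα hα'
  have hconv := fun x (hx : IsForwardSolution (M.rviField α f) x) =>
    SMDP.exists_tendsto_aoeSolutionsAt hM hf hα hα' hq₀ hx
  refine ⟨?_, ⟨SMDP.aoeSolutionsAt_nonempty hM hf hq₀,
    SMDP.isCompact_aoeSolutionsAt hM hW hf hα hα',
    fun ε hε => SMDP.exists_stability_radius hM hW hf hα hα' hε, fun x hx => ?_⟩, hconv⟩
  · ext q
    rw [Set.mem_ofPred_eq, SMDP.rviField_eq_zero_iff hα hα', hM.mem_aoeSolutionsAt_iff]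
  · obtain ⟨q, hq, hlim⟩ := hconv x hx
    exact squeeze_zero (fun _ => Metric.infDist_nonneg)
      (fun t => Metric.infDist_le_dist_of_mem hq) (tendsto_iff_dist_tendsto_zero.1 hlim)
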